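/- Let $M$ be a connected smooth manifold (Hausdorff, second countable, without boundary) of dimension $2n+1$. A contact metric structure $(\eta,\xi,\phi,g)$ on $M$ consists of a contact form $\eta$ (a smooth one-form such that $\eta\wedge(d\eta)^n$ vanishes nowhere), a smooth vector field $\xi$, a smooth field $\phi$ of endomorphisms of $TM$ and a smooth Riemannian metric $g$ such that $$g(\xi,\xi)=1,\quad \eta(\xi)=1,\quad \phi^2=-\mathrm{Id}+\eta\otimes\xi,\quad \phi\xi=0,\quad d\eta(X,Y)=2g(X,\phi Y),$$ where $d\eta(X,Y)=X(\eta(Y))-Y(\eta(X))-\eta([X,Y])$. An infinitesimal isometry is a smooth vector field $Z$ with $L_Zg=0$. The structure is K-contact if $\xi$ is an infinitesimal isometry. It is generalized Eta-Einstein if the Ricci operator $Q$ of $g$ satisfies $QX=\lambda X+\gamma\,\eta(X)\xi$ for some smooth functions $\lambda,\gamma$ on $M$ (constants are allowed). It is Einstein if $\mathrm{Ric}=c\,g$ for some constant $c\in\mathbb R$. **Theorem.** Let $(M,\eta,\xi,\phi,g)$ be a connected K-contact, generalized Eta-Einstein space which is not Einstein. Then every infinitesimal isometry $Z$ of $(M,g)$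 is an infinitesimal automorphism of the contact metric structure, that is, $L_Z\eta=0$, $[Z,\xi]=0$, $L_Z\phi=0$ and $L_Zg=0$. -/

import Mathlib

open scoped Manifold ContDiff Bundle

noncomputable section

namespace ContactGeometry

section Basic

variable {E : Type*} [NormedAddCommGroup E] [NormedSpace ℝ E]
  {M : Type*} [TopologicalSpace M] [ChartedSpace E M]

variable (E M) in
/-- Not necessarily continuous vector fields on `M`; regularity is always stated separately. -/
abbrev VField : Type _ := (x : M) → TangentSpace 𝓘(ℝ, E) x

variable (E M) in
/-- One-forms on `M`; regularity is always stated separately. -/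
abbrev OneForm : Type _ := (x : M) → (TangentSpace 𝓘(ℝ, E) x →L[ℝ] ℝ)

variable (E M) in
/-- Fields of endomorphisms of the tangent bundle; regularity is always stated separately. -/
abbrev EndField : Type _ :=
  (x : M) → (TangentSpace 𝓘(ℝ, E) x →L[ℝ] TangentSpace 𝓘(ℝ, E) x)

/-- The derivative `X(f)` of the function `f` in the direction of the vector field `X`. -/
def dirDeriv (X : VField E M) (f : M → ℝ) (x : M) : ℝ :=
  mvfderiv 𝓘(ℝ, E) f x (X x)

/-- The Lie bracket `[X, Y]`. -/
abbrev bracket (X Y : VField E M) : VField E M :=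
  VectorField.mlieBracket 𝓘(ℝ, E) X Y

/-- The value at `x` of the exterior derivative
`dη(X, Y) = X(η(Y)) - Y(η(X)) - η([X, Y])` of a one-form. -/
def dForm (η : OneForm E M) (X Y : VField E M) (x : M) : ℝ :=
  dirDeriv X (fun y => η y (Y y)) x - dirDeriv Y (fun y => η y (X y)) x
    - η x (bracket X Y x)

end Basic

section Manifold

variable {E : Type*} [NormedAddCommGroup E] [NormedSpace ℝ E]
  {M : Type*} [TopologicalSpace M] [ChartedSpace E M] [IsManifold 𝓘(ℝ, E) ∞ M]

/-- The vector field `X` is differentiable at the point `x`. -/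
def DiffAt (X : VField E M) (x : M) : Prop :=
  MDifferentiableAt 𝓘(ℝ, E) 𝓘(ℝ, E).tangent
    (fun y => (⟨y, X y⟩ : TangentBundle 𝓘(ℝ, E) M)) x

/-- The vector field `X` is smooth. -/
def SmoothVField (X : VField E M) : Prop :=
  ContMDiff 𝓘(ℝ, E) 𝓘(ℝ, E).tangent ∞
    (fun y => (⟨y, X y⟩ : TangentBundle 𝓘(ℝ, E) M))

variable (E M) in
/-- Smooth Riemannian metrics on `M`. -/
abbrev Metric : Type _ :=
  Bundle.ContMDiffRiemannianMetric 𝓘(ℝ, E) ∞ E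
    (fun x : M => TangentSpace 𝓘(ℝ, E) x)

/-- A vector field extending the tangent vector `v` at `x`; it is smooth near `x`
(it is constant in the preferred trivialization of the tangent bundle at `x`). -/
def ext {x : M} (v : TangentSpace 𝓘(ℝ, E) x) : VField E M :=
  FiberBundle.extend E v

/-- The one-form `η` is smooth. -/
def SmoothOneForm (η : OneForm E M) : Prop :=
  ContMDiff 𝓘(ℝ, E) (𝓘(ℝ, E).prod 𝓘(ℝ, E →L[ℝ] ℝ)) ∞
    (fun x => Bundle.TotalSpace.mk' (E →L[ℝ] ℝ)
      (E := fun y : M => TangentSpace 𝓘(ℝ, E) y →L[ℝ] Bundle.Trivial M ℝ y) x (η x))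

/-- The field of endomorphisms `φ` is smooth. -/
def SmoothEndField (φ : EndField E M) : Prop :=
  ContMDiff 𝓘(ℝ, E) (𝓘(ℝ, E).prod 𝓘(ℝ, E →L[ℝ] E)) ∞
    (fun x => Bundle.TotalSpace.mk' (E →L[ℝ] E)
      (E := fun y : M => TangentSpace 𝓘(ℝ, E) y →L[ℝ] TangentSpace 𝓘(ℝ, E) y) x (φ x))

/-- The exterior derivative `dη` as a bilinear form on the tangent space at `x`. -/
def dFormAt (η : OneForm E M) (x : M) (u v : TangentSpace 𝓘(ℝ, E) x) : ℝ :=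
  dForm η (ext u) (ext v) x

/-- The value of the `(2n+1)`-form `η ∧ (dη)^n` at `x` on `2n+1` tangent vectors, up to the
positive normalization factor of the wedge product. -/
def wedgeForm (n : ℕ) (η : OneForm E M) (x : M)
    (v : Fin (2 * n + 1) → TangentSpace 𝓘(ℝ, E) x) : ℝ :=
  ∑ σ : Equiv.Perm (Fin (2 * n + 1)), ((Equiv.Perm.sign σ : ℤ) : ℝ) *
    (η x (v (σ 0)) * ∏ i : Fin n,
      dFormAt η x (v (σ ⟨2 * (i : ℕ) + 1, by omega⟩)) (v (σ ⟨2 * (i : ℕ) + 2, by omega⟩)))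

/-- `η` is a contact form on a manifold of dimension `2n+1`: a smooth one-form such that the
top-degree form `η ∧ (dη)^n` vanishes nowhere. -/
def IsContactForm (n : ℕ) (η : OneForm E M) : Prop :=
  SmoothOneForm η ∧ ∀ x : M, ∃ v : Fin (2 * n + 1) → TangentSpace 𝓘(ℝ, E) x,
    wedgeForm n η x v ≠ 0

section Curvature

variable [FiniteDimensional ℝ E]

/-- A basis of the tangent space at `x`. -/
def tangentBasis (x : M) :
    Module.Basis (Fin (Module.finrank ℝ E)) ℝ (TangentSpace 𝓘(ℝ, E) x) :=
  (Module.finBasis ℝ E : Module.Basis (Fin (Module.finrank ℝ E)) ℝ E)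

/-- The matrix `g_ij` of the metric at `x`. -/
def gram (g : Metric E M) (x : M) :
    Matrix (Fin (Module.finrank ℝ E)) (Fin (Module.finrank ℝ E)) ℝ :=
  Matrix.of fun i j => g.inner x (tangentBasis x i) (tangentBasis x j)

/-- The metric dual of a linear functional `ℓ` on the tangent space at `x`, obtained by raising the
index with the inverse matrix `g^ij`: for linear `ℓ` it is the vector `w` with
`g(w, v) = ℓ v` for all `v`, see `inner_sharp`. -/
def sharp (g : Metric E M) (x : M) (ℓ : TangentSpace 𝓘(ℝ, E) x → ℝ) : TangentSpace 𝓘(ℝ, E) x :=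
  ∑ i, (∑ j, (gram g x)⁻¹ i j * ℓ (tangentBasis x j)) • tangentBasis x i

/-- Half of the right-hand side of the Koszul formula for `2 g(∇_X Y, Z)`. -/
def koszul (g : Metric E M) (X Y Z : VField E M) (x : M) : ℝ :=
  (1 / 2) *
    (dirDeriv X (fun y => g.inner y (Y y) (Z y)) x
      + dirDeriv Y (fun y => g.inner y (X y) (Z y)) x
      - dirDeriv Z (fun y => g.inner y (X y) (Y y)) x
      + g.inner x (bracket X Y x) (Z x)
      - g.inner x (bracket X Z x) (Y x)
      - g.inner x (bracket Y Z x) (X x))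

/-- The Levi-Civita connection `∇_X Y` of `g`, defined by the Koszul formula. -/
def leviCivita (g : Metric E M) (X Y : VField E M) : VField E M :=
  fun x => sharp g x (fun w => koszul g X Y (ext w) x)

/-- The curvature tensor `R(X, Y)Z = ∇_X ∇_Y Z - ∇_Y ∇_X Z - ∇_[X,Y] Z`. -/
def curvature (g : Metric E M) (X Y Z : VField E M) : VField E M :=
  leviCivita g X (leviCivita g Y Z) - leviCivita g Y (leviCivita g X Z)
    - leviCivita g (bracket X Y) Z

/-- The Ricci tensor at `x`: `Ric(v, w)` is the trace of `u ↦ R(u, v)w`. -/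
def ricci (g : Metric E M) (x : M) (v w : TangentSpace 𝓘(ℝ, E) x) : ℝ :=
  ∑ i, (tangentBasis x).coord i (curvature g (ext (tangentBasis x i)) (ext v) (ext w) x)

/-- The Ricci operator at `x`, that is, `g(Q v, w) = Ric(v, w)`. -/
def ricciOp (g : Metric E M) (x : M) (v : TangentSpace 𝓘(ℝ, E) x) : TangentSpace 𝓘(ℝ, E) x :=
  sharp g x (fun w => ricci g x v w)

/-- The metric is Einstein: `Ric = c g` for a constant `c`. -/
def IsEinstein (g : Metric E M) : Prop :=
  ∃ c : ℝ, ∀ (x : M) (v w : TangentSpace 𝓘(ℝ, E) x), ricci g x v w = c * g.inner x v w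

end Curvature

/-! Tensor identities are tested at each point on the vector fields differentiable there, which is
the same as testing them on all smooth vector fields. -/

/-- `L_Z g = 0`. -/
def LiePreservesMetric (g : Metric E M) (Z : VField E M) : Prop :=
  ∀ (x : M) (X Y : VField E M), DiffAt X x → DiffAt Y x →
    dirDeriv Z (fun y => g.inner y (X y) (Y y)) x
      - g.inner x (bracket Z X x) (Y x) - g.inner x (X x) (bracket Z Y x) = 0

/-- `L_Z η = 0`. -/
def LiePreservesForm (η : OneForm E M) (Z : VField E M) : Prop :=
  ∀ (x : M) (X : VField E M), DiffAt X x →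
    dirDeriv Z (fun y => η y (X y)) x - η x (bracket Z X x) = 0

/-- `L_Z φ = 0`. -/
def LiePreservesEnd (φ : EndField E M) (Z : VField E M) : Prop :=
  ∀ (x : M) (X : VField E M), DiffAt X x →
    bracket Z (fun y => φ y (X y)) x - φ x (bracket Z X x) = 0

/-- An infinitesimal isometry (Killing vector field). -/
def IsInfinitesimalIsometry (g : Metric E M) (Z : VField E M) : Prop :=
  SmoothVField Z ∧ LiePreservesMetric g Z

variable (E M) in
/-- A contact metric structure `(η, ξ, φ, g)` on a manifold `M` of dimension `2n+1`. -/
structure ContactMetricStructure (n : ℕ) where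
  /-- The contact form. -/
  η : OneForm E M
  /-- The Reeb field. -/
  ξ : VField E M
  /-- The structure endomorphism. -/
  φ : EndField E M
  /-- The metric. -/
  g : Metric E M
  contact : IsContactForm n η
  smooth_ξ : SmoothVField ξ
  smooth_φ : SmoothEndField φ
  unit_ξ : ∀ x, g.inner x (ξ x) (ξ x) = 1
  η_ξ : ∀ x, η x (ξ x) = 1
  φ_sq : ∀ (x : M) (v : TangentSpace 𝓘(ℝ, E) x), φ x (φ x v) = -v + η x v • ξ x
  φ_ξ : ∀ x, φ x (ξ x) = 0
  dη_eq : ∀ (x : M) (X Y : VField E M), DiffAt X x → DiffAt Y x →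
    dForm η X Y x = 2 * g.inner x (X x) (φ x (Y x))

namespace ContactMetricStructure

variable {n : ℕ} (S : ContactMetricStructure E M n)

/-- K-contact: the Reeb field is an infinitesimal isometry. -/
def IsKContact : Prop := IsInfinitesimalIsometry S.g S.ξ

/-- Generalized Eta-Einstein: `Q X = lam X + gam η(X) ξ` for smooth functions `lam` and `gam`. -/
def IsGeneralizedEtaEinstein [FiniteDimensional ℝ E] : Prop :=
  ∃ lam gam : M → ℝ, ContMDiff 𝓘(ℝ, E) 𝓘(ℝ) ∞ lam ∧ ContMDiff 𝓘(ℝ, E) 𝓘(ℝ) ∞ gam ∧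
    ∀ (x : M) (v : TangentSpace 𝓘(ℝ, E) x),
      ricciOp S.g x v = lam x • v + (gam x * S.η x v) • S.ξ x

/-- An infinitesimal automorphism of the contact metric structure: a smooth vector field whose flow
preserves each of `η`, `ξ`, `φ` and `g`. -/
def IsInfinitesimalAutomorphism (Z : VField E M) : Prop :=
  SmoothVField Z ∧ LiePreservesForm S.η Z ∧ (∀ x, bracket Z S.ξ x = 0) ∧
    LiePreservesEnd S.φ Z ∧ LiePreservesMetric S.g Z

end ContactMetricStructure

section Musical

variable [FiniteDimensional ℝ E]

theorem isUnit_gram (g : Metric E M) (x : M) : IsUnit (gram g x).det := by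
  rw [isUnit_iff_ne_zero]
  intro h
  obtain ⟨c, hc, h0⟩ := Matrix.exists_mulVec_eq_zero_iff.2 h
  obtain ⟨w, hw⟩ : ∃ w, w = ∑ j, c j • tangentBasis (E := E) x j := ⟨_, rfl⟩
  have hne : w ≠ 0 := fun hs => hc (funext
    ((Fintype.linearIndependent_iff.1 (tangentBasis x).linearIndependent) c (hw.symm.trans hs)))
  have hz : ∀ i, g.inner x (tangentBasis x i) w = 0 := by
    intro i
    have := congrFun h0 i
    simp only [Matrix.mulVec, dotProduct, gram, Matrix.of_apply, Pi.zero_apply] at this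
    rw [hw, map_sum, ← this]
    refine Finset.sum_congr rfl fun j _ => ?_
    rw [map_smul, smul_eq_mul, mul_comm]
  have h1 : g.inner x w w = 0 := by
    conv_lhs => rw [g.symm]; arg 2; rw [hw]
    rw [map_sum]
    refine Finset.sum_eq_zero fun j _ => ?_
    rw [map_smul, g.symm, hz, smul_zero]
  exact (g.pos x w hne).ne' h1

theorem inner_sharp (g : Metric E M) (x : M) (ℓ : TangentSpace 𝓘(ℝ, E) x →ₗ[ℝ] ℝ)
    (v : TangentSpace 𝓘(ℝ, E) x) : g.inner x (sharp g x ℓ) v = ℓ v := by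
  have key : ((g.inner x (sharp g x ℓ)) : TangentSpace 𝓘(ℝ, E) x →ₗ[ℝ] ℝ) = ℓ := by
    refine (tangentBasis x).ext fun k => ?_
    have h1 : ∀ j, ∑ i, gram g x k i * (gram g x)⁻¹ i j = if k = j then 1 else 0 := by
      intro j
      have := congrFun (congrFun (Matrix.mul_nonsing_inv _ (isUnit_gram g x)) k) j
      rwa [Matrix.mul_apply, Matrix.one_apply] at this
    calc g.inner x (sharp g x ℓ) (tangentBasis x k)
        = ∑ i, (∑ j, (gram g x)⁻¹ i j * ℓ (tangentBasis x j)) * gram g x k i := by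
          rw [g.symm, sharp, map_sum]
          refine Finset.sum_congr rfl fun i _ => ?_
          rw [map_smul, smul_eq_mul]; rfl
      _ = ∑ j, (∑ i, gram g x k i * (gram g x)⁻¹ i j) * ℓ (tangentBasis x j) := by
          simp only [Finset.sum_mul]
          rw [Finset.sum_comm]
          refine Finset.sum_congr rfl fun j _ => Finset.sum_congr rfl fun i _ => ?_
          ring
      _ = ℓ (tangentBasis x k) := by simp [h1]
  exact congrArg (fun f : TangentSpace 𝓘(ℝ, E) x →ₗ[ℝ] ℝ => f v) key

end Musical

end Manifold

end ContactGeometry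

end

/-! On a K-contact manifold ∇_X ξ = -φX, hence R(X, ξ)ξ = X - η(X)ξ and Ric(ξ, ξ) = 2n. If Ric = λg
+ γ η⊗η, this forces λ + γ = 2n, so that Ric(X, ξ) = 2n η(X), with a constant factor even when λ and
γ vary.

A Killing field Z preserves the Levi-Civita connection, the curvature and its trace Ric. Evaluating
L_Z Ric = 0 on (X, ξ), with η = g(ξ, ·) and η([Z, ξ]) = 0, leaves γ g([Z, ξ], X) = 0
(`KContact.ev_gam_lie_ξ`). So [Z, ξ] vanishes on the open set γ ≠ 0, which is nonempty: if γ were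
identically zero, then Ric = 2n g. As a bracket of Killing fields, [Z, ξ] is Killing, and a Killing
field on a connected manifold that vanishes on a nonempty open set is zero (`killing_eq_zero`). Thus
[Z, ξ] = 0 everywhere; then L_Z preserves η = g(ξ, ·), hence dη, hence φ, which dη and g determine.

The tensor calculus is carried out algebraically, over the ring of smooth functions acting on the
module of smooth vector fields (`MetricLieRinehart`). Traces need frames, which exist only locally;
`CutoffFrame` makes them global objects, and identities are read off where the cut-off is 1. The
bridge to the pointwise definitions consists of `inner_leviCivita`, `lieRinehart` and
`ricci_eq_ric`.

Unique continuation rests on prolongation: in a frame e_i, the components of V and of all [V, e_i]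
satisfy a closed linear first-order system, so Grönwall's inequality along segments in a chart
propagates their vanishing. -/

noncomputable section

namespace ContactGeometry

set_option linter.unusedSectionVars false

/-- A Lie-Rinehart pair with a nondegenerate symmetric form and its Levi-Civita connection. -/
structure MetricLieRinehart (A L : Type*) [CommRing A] [Algebra ℝ A] [LieRing L] [Module A L] where
  /-- The anchor: vector fields act on functions as derivations. -/
  D : L →ₗ[A] Derivation ℝ A A
  D_lie : ∀ (X Y : L) (f : A), D ⁅X, Y⁆ f = D X (D Y f) - D Y (D X f)
  lie_smul : ∀ (X Y : L) (f : A), ⁅X, f • Y⁆ = D X f • Y + f • ⁅X, Y⁆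
  /-- The metric. -/
  g : L →ₗ[A] L →ₗ[A] A
  symm : ∀ X Y, g X Y = g Y X
  nondeg : ∀ X, (∀ Y, g X Y = 0) → X = 0
  /-- The Levi-Civita connection. -/
  nabla : L → L → L
  koszul : ∀ X Y Z, 2 * g (nabla X Y) Z = D X (g Y Z) + D Y (g X Z) - D Z (g X Y)
    + g ⁅X, Y⁆ Z - g ⁅X, Z⁆ Y - g ⁅Y, Z⁆ X

/-! ### Levi-Civita connection and curvature, algebraically -/

namespace MetricLieRinehart

variable {A L : Type*} [CommRing A] [Algebra ℝ A] [LieRing L] [Module A L]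
  (S : MetricLieRinehart A L)

theorem two_mul_cancel {a b : A} (h : 2 * a = 2 * b) : a = b := by
  have h2 : (algebraMap ℝ A (1 / 2)) * 2 = 1 := by
    rw [← map_ofNat (algebraMap ℝ A) 2, ← map_mul]; norm_num
  calc a = (algebraMap ℝ A (1 / 2)) * (2 * a) := by rw [← mul_assoc, h2, one_mul]
    _ = b := by rw [h, ← mul_assoc, h2, one_mul]

theorem ext_inner {X Y : L} (h : ∀ Z, S.g X Z = S.g Y Z) : X = Y :=
  sub_eq_zero.1 (S.nondeg _ fun Z => by simp [h Z])

theorem ext_two_inner {X Y : L} (h : ∀ Z, 2 * S.g X Z = 2 * S.g Y Z) : X = Y :=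
  S.ext_inner fun Z => two_mul_cancel (h Z)

theorem D_mul (X : L) (f h : A) : S.D X (f * h) = S.D X f * h + f * S.D X h := by
  rw [Derivation.leibniz, smul_eq_mul, smul_eq_mul]; ring

theorem smul_lie (f : A) (X Y : L) : ⁅f • X, Y⁆ = f • ⁅X, Y⁆ - S.D Y f • X := by
  rw [← lie_skew, S.lie_smul, ← lie_skew X Y]; module

theorem nabla_add_left (X X' Y : L) : S.nabla (X + X') Y = S.nabla X Y + S.nabla X' Y := by
  refine S.ext_two_inner fun Z => ?_
  simp only [map_add, LinearMap.add_apply, mul_add, S.koszul, Derivation.add_apply, add_lie]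
  ring

theorem nabla_add_right (X Y Y' : L) : S.nabla X (Y + Y') = S.nabla X Y + S.nabla X Y' := by
  refine S.ext_two_inner fun Z => ?_
  simp only [map_add, LinearMap.add_apply, mul_add, S.koszul, Derivation.add_apply, add_lie, lie_add]
  ring

theorem nabla_smul_left (f : A) (X Y : L) : S.nabla (f • X) Y = f • S.nabla X Y := by
  refine S.ext_two_inner fun Z => ?_
  rw [map_smul, LinearMap.smul_apply, smul_eq_mul, mul_left_comm, S.koszul, S.koszul]
  simp only [S.smul_lie, map_smul, LinearMap.smul_apply, smul_eq_mul, map_sub, LinearMap.sub_apply,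
    S.D_mul, Derivation.smul_apply]
  rw [S.symm X Y, S.symm X Z]
  ring

theorem nabla_smul_right (f : A) (X Y : L) :
    S.nabla X (f • Y) = S.D X f • Y + f • S.nabla X Y := by
  refine S.ext_two_inner fun Z => ?_
  rw [map_add, LinearMap.add_apply, map_smul, map_smul, LinearMap.smul_apply, LinearMap.smul_apply,
    smul_eq_mul, smul_eq_mul, mul_add, mul_left_comm _ f, S.koszul, S.koszul]
  simp only [S.smul_lie, S.lie_smul, map_smul, LinearMap.smul_apply, smul_eq_mul, map_sub, map_add,
    LinearMap.add_apply, LinearMap.sub_apply, S.D_mul, Derivation.smul_apply]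
  rw [S.symm X Y, S.symm Y Z]
  ring

/-- The connection as a bi-additive map. -/
def nablaHom : L →+ L →+ L :=
  AddMonoidHom.mk' (fun X => AddMonoidHom.mk' (S.nabla X) (S.nabla_add_right X))
    fun X X' => by ext Y; exact S.nabla_add_left X X' Y

@[simp] theorem nablaHom_apply (X Y : L) : S.nablaHom X Y = S.nabla X Y := rfl

theorem nabla_neg_left (X Y : L) : S.nabla (-X) Y = -S.nabla X Y := by
  rw [← nablaHom_apply, map_neg]; rfl

theorem nabla_neg_right (X Y : L) : S.nabla X (-Y) = -S.nabla X Y := by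
  rw [← nablaHom_apply, map_neg]; rfl

theorem nabla_sub_left (X X' Y : L) : S.nabla (X - X') Y = S.nabla X Y - S.nabla X' Y := by
  rw [← nablaHom_apply, map_sub]; rfl

theorem nabla_zero_right (X : L) : S.nabla X 0 = 0 := by
  rw [← nablaHom_apply, map_zero]

theorem nabla_sum_left {ι : Type*} (s : Finset ι) (X : ι → L) (Y : L) :
    S.nabla (∑ i ∈ s, X i) Y = ∑ i ∈ s, S.nabla (X i) Y := by
  rw [← nablaHom_apply, map_sum, AddMonoidHom.finsetSum_apply]; rfl

theorem torsion_free (X Y : L) : S.nabla X Y - S.nabla Y X = ⁅X, Y⁆ := by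
  refine S.ext_two_inner fun Z => ?_
  rw [map_sub, LinearMap.sub_apply, mul_sub, S.koszul, S.koszul, S.symm Y X, ← lie_skew X Y]
  simp only [map_neg, LinearMap.neg_apply]
  ring

theorem metric_compat (X Y Z : L) :
    S.D X (S.g Y Z) = S.g (S.nabla X Y) Z + S.g Y (S.nabla X Z) := by
  refine two_mul_cancel ?_
  rw [mul_add, S.symm Y (S.nabla X Z), S.koszul, S.koszul, S.symm Z Y, ← lie_skew Y Z]
  simp only [map_neg, LinearMap.neg_apply]
  ring

/-- The curvature tensor. -/
def R (X Y Z : L) : L :=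
  S.nabla X (S.nabla Y Z) - S.nabla Y (S.nabla X Z) - S.nabla ⁅X, Y⁆ Z

theorem R_add₁ (X X' Y Z : L) : S.R (X + X') Y Z = S.R X Y Z + S.R X' Y Z := by
  simp only [R, S.nabla_add_left, S.nabla_add_right, add_lie]; abel

theorem R_skew (X Y Z : L) : S.R X Y Z = -S.R Y X Z := by
  simp only [R, ← lie_skew X Y, S.nabla_neg_left]; abel

theorem R_add₂ (X Y Y' Z : L) : S.R X (Y + Y') Z = S.R X Y Z + S.R X Y' Z := by
  simp only [R, S.nabla_add_left, S.nabla_add_right, lie_add]; abel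

theorem R_add₃ (X Y Z Z' : L) : S.R X Y (Z + Z') = S.R X Y Z + S.R X Y Z' := by
  simp only [R, S.nabla_add_right]; abel

theorem R_smul₁ (f : A) (X Y Z : L) : S.R (f • X) Y Z = f • S.R X Y Z := by
  simp only [R, S.nabla_smul_left, S.nabla_smul_right, S.smul_lie, S.nabla_sub_left]
  module

theorem R_smul₂ (f : A) (X Y Z : L) : S.R X (f • Y) Z = f • S.R X Y Z := by
  rw [S.R_skew, S.R_smul₁, S.R_skew Y X]; module

theorem R_smul₃ (f : A) (X Y Z : L) : S.R X Y (f • Z) = f • S.R X Y Z := by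
  simp only [R, S.nabla_smul_right, S.nabla_add_right, S.D_lie]
  module

/-- The curvature as a trilinear map. -/
def RHom : L →ₗ[A] L →ₗ[A] L →ₗ[A] L :=
  LinearMap.mk₂ A (fun X Y =>
    { toFun := S.R X Y, map_add' := S.R_add₃ X Y, map_smul' := fun f Z => S.R_smul₃ f X Y Z })
    (fun X X' Y => LinearMap.ext fun Z => S.R_add₁ X X' Y Z)
    (fun f X Y => LinearMap.ext fun Z => S.R_smul₁ f X Y Z)
    (fun X Y Y' => LinearMap.ext fun Z => S.R_add₂ X Y Y' Z)
    (fun f X Y => LinearMap.ext fun Z => S.R_smul₂ f X Y Z)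

@[simp] theorem RHom_apply (X Y Z : L) : S.RHom X Y Z = S.R X Y Z := rfl

/-- The Lie derivative of the metric along `Z` vanishes. -/
def IsKilling (Z : L) : Prop :=
  ∀ X Y, S.D Z (S.g X Y) = S.g ⁅Z, X⁆ Y + S.g X ⁅Z, Y⁆

/-! ### Killing fields preserve the connection and the curvature -/

variable {S}

/-- The Koszul formula expresses ∇ through the metric, the anchor and the bracket. Differentiating
it along Z, each ingredient obeys a Leibniz rule: the metric by hypothesis, the bracket by Jacobi.
-/
theorem IsKilling.lie_nabla {Z : L} (hZ : S.IsKilling Z) (X Y : L) :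
    ⁅Z, S.nabla X Y⁆ = S.nabla ⁅Z, X⁆ Y + S.nabla X ⁅Z, Y⁆ := by
  refine S.ext_two_inner fun W => ?_
  have h1 : S.g ⁅Z, S.nabla X Y⁆ W = S.D Z (S.g (S.nabla X Y) W) - S.g (S.nabla X Y) ⁅Z, W⁆ := by
    rw [hZ]; ring
  have h2 : 2 * S.D Z (S.g (S.nabla X Y) W) = S.D Z (2 * S.g (S.nabla X Y) W) := by
    rw [two_mul, two_mul, map_add]
  have hD : ∀ U V V', S.D Z (S.D U (S.g V V')) =
      S.D ⁅Z, U⁆ (S.g V V') + S.D U (S.g ⁅Z, V⁆ V') + S.D U (S.g V ⁅Z, V'⁆) := by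
    intro U V V'
    rw [S.D_lie, hZ, map_add]; ring
  rw [map_add, LinearMap.add_apply, mul_add, h1, mul_sub, h2, S.koszul, S.koszul, S.koszul,
    S.koszul]
  simp only [map_add, map_sub, hD, hZ ⁅_, _⁆, leibniz_lie Z, LinearMap.add_apply]
  ring

theorem IsKilling.lie_R {Z : L} (hZ : S.IsKilling Z) (X Y W : L) :
    ⁅Z, S.R X Y W⁆ = S.R ⁅Z, X⁆ Y W + S.R X ⁅Z, Y⁆ W + S.R X Y ⁅Z, W⁆ := by
  simp only [R, lie_sub, hZ.lie_nabla, S.nabla_add_right, leibniz_lie Z X Y, S.nabla_add_left]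
  abel

theorem IsKilling.lie {Z W : L} (hZ : S.IsKilling Z) (hW : S.IsKilling W) :
    S.IsKilling ⁅Z, W⁆ := by
  intro X Y
  rw [S.D_lie, hW, hZ X Y, map_add, map_add, hZ, hZ, hW, hW]
  simp only [lie_lie, map_sub, LinearMap.sub_apply]
  ring

variable (S)

/-- A K-contact metric structure on a metric Lie-Rinehart pair. -/
structure KContact where
  /-- The contact form. -/
  η : L →ₗ[A] A
  /-- The Reeb field. -/
  ξ : L
  /-- The structure endomorphism. -/
  φ : L →ₗ[A] L
  unit : S.g ξ ξ = 1
  η_ξ : η ξ = 1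
  φ_sq : ∀ X, φ (φ X) = -X + η X • ξ
  φ_ξ : φ ξ = 0
  dη : ∀ X Y, S.D X (η Y) - S.D Y (η X) - η ⁅X, Y⁆ = 2 * S.g X (φ Y)
  killing : S.IsKilling ξ

/-! ### K-contact identities -/

namespace KContact

variable {S} (K : S.KContact)

theorem φ_skew (X Y : L) : S.g X (K.φ Y) = -S.g (K.φ X) Y := by
  refine two_mul_cancel ?_
  rw [mul_neg, S.symm _ Y, ← K.dη, ← K.dη, ← lie_skew X Y, map_neg]; ring

theorem φ_inner (X Y : L) : S.g (K.φ X) (K.φ Y) = S.g X Y - K.η Y * S.g X K.ξ := by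
  have := K.φ_skew X (K.φ Y)
  rw [K.φ_sq, map_add, map_neg, map_smul, smul_eq_mul] at this
  linear_combination this

/-- Metric duality of η and ξ is not an axiom. It comes from g(φX, φY) = g(X, Y) - η(Y) g(X, ξ) with
ξ in the first slot, where φξ = 0 kills the left side. -/
theorem η_eq (X : L) : K.η X = S.g K.ξ X := by
  have h1 := K.φ_inner X K.ξ
  have h2 := K.φ_inner K.ξ X
  rw [S.symm (K.φ K.ξ), h1, K.η_ξ, K.unit, S.symm X] at h2
  linear_combination h2

theorem lie_η {Z : L} (hZ : S.IsKilling Z) (hξ : ⁅Z, K.ξ⁆ = 0) (X : L) :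
    S.D Z (K.η X) = K.η ⁅Z, X⁆ := by
  rw [K.η_eq, K.η_eq, hZ, hξ]; simp

/-- L_Z commutes with d, so L_Z η = 0 gives L_Z dη = 0. Since dη = 2g(·, φ·) with g preserved and
nondegenerate, φ is preserved too. -/
theorem lie_φ {Z : L} (hZ : S.IsKilling Z) (hξ : ⁅Z, K.ξ⁆ = 0) (Y : L) :
    ⁅Z, K.φ Y⁆ = K.φ ⁅Z, Y⁆ := by
  refine S.ext_two_inner fun X => ?_
  have hD : ∀ U V, S.D Z (S.D U (K.η V)) = S.D ⁅Z, U⁆ (K.η V) + S.D U (K.η ⁅Z, V⁆) := by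
    intro U V
    rw [S.D_lie, K.lie_η hZ hξ]; ring
  have h1 := K.dη X Y
  have h2 := K.dη ⁅Z, X⁆ Y
  have h3 := K.dη X ⁅Z, Y⁆
  have h4 := congrArg (S.D Z) h1
  rw [map_sub, map_sub, hD, hD, K.lie_η hZ hξ, leibniz_lie, map_add, two_mul, map_add, hZ] at h4
  rw [S.symm _ X, S.symm _ X]
  linear_combination -h4 + h2 + h3

/-- The Killing equation says that the symmetric part of ∇ξ vanishes; dη supplies the skew part. -/
theorem nabla_ξ (X : L) : S.nabla X K.ξ = -K.φ X := by
  refine S.ext_two_inner fun Y => ?_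
  have h1 := K.killing X Y
  have h2 := K.dη X Y
  rw [← S.torsion_free, ← S.torsion_free, S.metric_compat] at h1
  rw [← S.torsion_free, K.η_eq, K.η_eq, K.η_eq, S.metric_compat, S.metric_compat, K.φ_skew,
    S.symm (S.nabla Y K.ξ) X] at h2
  simp only [map_sub, map_neg, LinearMap.sub_apply, LinearMap.neg_apply] at h1 h2 ⊢
  linear_combination h2 + h1

/-- Since ∇_ξ ξ = 0, R(X, ξ)ξ = ∇_ξ(φX) - φ[ξ, X]. By L_ξ φ = 0 this is ∇_ξ(φX) - [ξ, φX] = ∇_{φX} ξ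
= -φ²X. -/
theorem R_ξ_ξ (X : L) : S.R X K.ξ K.ξ = X - K.η X • K.ξ := by
  have h1 := K.lie_φ K.killing (lie_self _) X
  rw [← S.torsion_free, K.nabla_ξ, K.φ_sq] at h1
  have h2 : K.φ ⁅X, K.ξ⁆ = -K.φ ⁅K.ξ, X⁆ := by rw [← lie_skew, map_neg]
  rw [R, K.nabla_ξ, K.nabla_ξ, K.nabla_ξ, K.φ_ξ, neg_zero, S.nabla_zero_right, S.nabla_neg_right,
    h2, ← h1]
  abel

end KContact

/-- A local frame and its dual coframe, cut off by a function `ρ`. -/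
structure _root_.ContactGeometry.CutoffFrame (A L ι : Type*) [Fintype ι] [DecidableEq ι]
    [CommRing A] [AddCommGroup L] [Module A L] where
  /-- The frame. -/
  e : ι → L
  /-- The coframe. -/
  θ : ι → L →ₗ[A] A
  /-- The cut-off function. -/
  ρ : A
  sum_eq : ∀ X, ∑ i, θ i X • e i = ρ • X
  dual : ∀ i j, θ i (e j) = if i = j then ρ else 0

/-! ### Traces in a cut-off frame, and the Ricci tensor -/

variable {ι : Type*} [Fintype ι] [DecidableEq ι] (F : CutoffFrame A L ι)
  {B : Type*} [CommRing B] {ev : A →+* B}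

/-- Z(tr T) = tr(L_Z T). Expanding [Z, e_i] and T(e_i) in the frame produces two double sums that
cancel, as in the trace of a commutator. The map `ev` is meant as evaluation at a point where ρ is 1
to first order along Z. -/
theorem ev_trace_lie {Z : L} (hρ : ev F.ρ = 1) (hdρ : ev (S.D Z F.ρ) = 0) (T : L →ₗ[A] L) :
    ev (S.D Z (∑ i, F.θ i (T (F.e i)))) = ev (∑ i, F.θ i (⁅Z, T (F.e i)⁆ - T ⁅Z, F.e i⁆)) := by
  have h1 : ∀ i, ev (F.θ i (T ⁅Z, F.e i⁆)) =
      ∑ j, ev (F.θ j ⁅Z, F.e i⁆) * ev (F.θ i (T (F.e j))) := by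
    intro i
    have := congrArg (fun X => ev (F.θ i (T X))) (F.sum_eq ⁅Z, F.e i⁆)
    simp only [map_sum, map_smul, smul_eq_mul, map_mul, hρ, one_mul] at this
    exact this.symm
  have h2 : ∀ i, ev (F.θ i ⁅Z, T (F.e i)⁆) = ev (S.D Z (F.θ i (T (F.e i)))) +
      ∑ j, ev (F.θ j (T (F.e i))) * ev (F.θ i ⁅Z, F.e j⁆) := by
    intro i
    have := congrArg (fun X => ev (F.θ i ⁅Z, X⁆)) (F.sum_eq (T (F.e i)))
    simp only [lie_sum, S.lie_smul, map_sum, map_add, map_smul, smul_eq_mul, map_mul, hρ, hdρ,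
      F.dual, one_mul, zero_mul, zero_add, Finset.sum_add_distrib] at this
    rw [← this]
    congr 1
    rw [Finset.sum_eq_single i]
    · simp [hρ]
    · intro j _ hj; simp [hj.symm]
    · simp
  simp only [map_sum, map_sub, Finset.sum_sub_distrib, h1, h2, Finset.sum_add_distrib]
  rw [Finset.sum_comm (f := fun i j => ev (F.θ j ⁅Z, F.e i⁆) * ev (F.θ i (T (F.e j))))]
  simp only [mul_comm (ev (F.θ _ (T _)))]
  ring

/-- The Ricci tensor computed in a frame. -/
def ric (X Y : L) : A := ∑ i, F.θ i (S.R (F.e i) X Y)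

variable {S}

theorem IsKilling.ev_ric {Z : L} (hZ : S.IsKilling Z) (hρ : ev F.ρ = 1) (hdρ : ev (S.D Z F.ρ) = 0)
    (X Y : L) : ev (S.D Z (S.ric F X Y)) = ev (S.ric F ⁅Z, X⁆ Y) + ev (S.ric F X ⁅Z, Y⁆) := by
  have := S.ev_trace_lie F hρ hdρ ((S.RHom.flip X).flip Y)
  simp only [LinearMap.flip_apply, RHom_apply] at this
  rw [ric, this, ← map_add, ric, ric, ← Finset.sum_add_distrib]
  congr 1
  refine Finset.sum_congr rfl fun i _ => ?_
  rw [← map_add, hZ.lie_R]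
  congr 1
  abel

/-- The trace of Id - η⊗ξ is the rank of the frame minus η(ξ) = 1. -/
theorem KContact.ev_ric_ξ_ξ (K : S.KContact) (hρ : ev F.ρ = 1) :
    ev (S.ric F K.ξ K.ξ) = Fintype.card ι - 1 := by
  have h := congrArg (fun X => ev (K.η X)) (F.sum_eq K.ξ)
  simp only [map_sum, map_smul, smul_eq_mul, map_mul, hρ, one_mul, K.η_ξ, map_one] at h
  simp only [ric, K.R_ξ_ξ, map_sub, map_smul, smul_eq_mul, F.dual, map_sum, if_true, hρ, map_mul,
    Finset.sum_sub_distrib]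
  rw [Finset.sum_congr rfl fun i _ => mul_comm (ev (K.η (F.e i))) _, h]
  simp

/-- If the Ricci tensor is `lam g + gam η ⊗ η` near a point, with constant `lam + gam`, then
Killing fields commute with the Reeb field where `gam` does not vanish. -/
theorem KContact.ev_gam_lie_ξ (K : S.KContact) {lam gam : A} {c : ℝ}
    (hc : lam + gam = algebraMap ℝ A c) {Z : L} (hZ : S.IsKilling Z)
    (hρ : ev F.ρ = 1) (hdρ : ev (S.D Z F.ρ) = 0)
    (h0 : ∀ X Y, ev (S.ric F X Y) = ev (lam * S.g X Y + gam * (K.η X * K.η Y)))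
    (h1 : ∀ X Y, ev (S.D Z (S.ric F X Y)) =
      ev (S.D Z (lam * S.g X Y + gam * (K.η X * K.η Y)))) (X : L) :
    ev gam * ev (S.g ⁅Z, K.ξ⁆ X) = 0 := by
  have h2 : ∀ X, lam * S.g X K.ξ + gam * (K.η X * K.η K.ξ) = algebraMap ℝ A c * K.η X := by
    intro X
    rw [← hc, K.η_ξ, K.η_eq, S.symm X]; ring
  -- Differentiate g(ξ, ξ) = 1 along Z.
  have h3 : K.η ⁅Z, K.ξ⁆ = 0 := by
    refine two_mul_cancel ?_
    have := hZ K.ξ K.ξ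
    rw [K.unit, Derivation.map_one_eq_zero, S.symm _ K.ξ, ← K.η_eq] at this
    linear_combination -this
  -- L_Z Ric = 0 on (X, ξ). The derivative of the Ricci tensor enters through `h1`, because equality
  -- of values under `ev` says nothing about derivatives.
  have h := hZ.ev_ric F hρ hdρ X K.ξ
  rw [h1, h0, h0, h2, h2, ← map_add, h3, S.D_mul, Derivation.map_algebraMap, ← hc, K.η_eq, hZ,
    S.symm X ⁅Z, K.ξ⁆, ← K.η_eq ⁅Z, X⁆] at h
  simp only [map_add, map_mul, map_zero] at h
  linear_combination h

end MetricLieRinehart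

/-! ### Differential calculus of vector fields at a point -/

section Pointwise

variable {E : Type*} [NormedAddCommGroup E] [NormedSpace ℝ E]
  {M : Type*} [TopologicalSpace M] [ChartedSpace E M] [IsManifold 𝓘(ℝ, E) ∞ M]

theorem SmoothVField.diffAt {X : VField E M} (h : SmoothVField X) (x : M) : DiffAt X x :=
  (h x).mdifferentiableAt (by simp)

@[simp] theorem ext_self {x : M} (v : TangentSpace 𝓘(ℝ, E) x) : ext v x = v :=
  FiberBundle.extend_apply_self _ v

theorem dirDeriv_add (X : VField E M) {f h : M → ℝ} {x : M}
    (hf : MDifferentiableAt 𝓘(ℝ, E) 𝓘(ℝ, ℝ) f x) (hh : MDifferentiableAt 𝓘(ℝ, E) 𝓘(ℝ, ℝ) h x) :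
    dirDeriv X (f + h) x = dirDeriv X f x + dirDeriv X h x := by
  rw [dirDeriv, mvfderiv_add hf hh]; rfl

theorem dirDeriv_mul (X : VField E M) {f h : M → ℝ} {x : M}
    (hf : MDifferentiableAt 𝓘(ℝ, E) 𝓘(ℝ, ℝ) f x) (hh : MDifferentiableAt 𝓘(ℝ, E) 𝓘(ℝ, ℝ) h x) :
    dirDeriv X (f * h) x = f x * dirDeriv X h x + h x * dirDeriv X f x := by
  rw [dirDeriv, mvfderiv_mul hf hh]; rfl

theorem dirDeriv_const (X : VField E M) (c : ℝ) (x : M) : dirDeriv X (fun _ => c) x = 0 := by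
  rw [dirDeriv, mvfderiv_const]; rfl

theorem dirDeriv_add_left (X Y : VField E M) (f : M → ℝ) (x : M) :
    dirDeriv (X + Y) f x = dirDeriv X f x + dirDeriv Y f x :=
  map_add _ _ _

theorem dirDeriv_smul_left (h : M → ℝ) (X : VField E M) (f : M → ℝ) (x : M) :
    dirDeriv (h • X) f x = h x * dirDeriv X f x :=
  map_smul (mvfderiv 𝓘(ℝ, E) f x) _ _

theorem dirDeriv_congr {X X' : VField E M} {f f' : M → ℝ} {x : M} (hX : X x = X' x)
    (hf : f =ᶠ[nhds x] f') : dirDeriv X f x = dirDeriv X' f' x := by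
  have h : mvfderiv 𝓘(ℝ, E) f x = mvfderiv 𝓘(ℝ, E) f' x := by
    ext v
    exact congrArg (fun T : E →L[ℝ] ℝ => T v) hf.mfderiv_eq
  rw [dirDeriv, dirDeriv, h, hX]

theorem smooth_dirDeriv {X : VField E M} {f : M → ℝ} (hX : SmoothVField X)
    (hf : ContMDiff 𝓘(ℝ, E) 𝓘(ℝ, ℝ) ∞ f) : ContMDiff 𝓘(ℝ, E) 𝓘(ℝ, ℝ) ∞ (dirDeriv X f) := by
  have h1 := hf.contMDiff_tangentMap (m := ∞) (by simp)
  exact (contMDiff_snd_tangentBundle_modelSpace ℝ 𝓘(ℝ, ℝ)).comp (h1.comp hX)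

theorem contMDiffAt_inner (g : Metric E M) {X Y : VField E M} {x : M}
    (hX : CMDiffAt ∞ (T% X) x) (hY : CMDiffAt ∞ (T% Y) x) :
    ContMDiffAt 𝓘(ℝ, E) 𝓘(ℝ, ℝ) ∞ (fun y => g.inner y (X y) (Y y)) x := by
  have h := (g.contMDiff x).clm_bundle_apply₂ hX hY
  simp only [Bundle.contMDiffAt_totalSpace] at h
  exact h.2

theorem mdifferentiableAt_inner (g : Metric E M) {X Y : VField E M} {x : M}
    (hX : DiffAt X x) (hY : DiffAt Y x) :
    MDifferentiableAt 𝓘(ℝ, E) 𝓘(ℝ, ℝ) (fun y => g.inner y (X y) (Y y)) x := by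
  have h1 := (g.contMDiff x).mdifferentiableAt (n := ∞) (by simp)
  have h := MDifferentiableAt.clm_bundle_apply₂ h1 hX hY
  simp only [mdifferentiableAt_totalSpace] at h
  exact h.2

theorem contMDiffAt_oneForm {η : OneForm E M} (hη : SmoothOneForm η) {X : VField E M} {x : M}
    (hX : CMDiffAt ∞ (T% X) x) : ContMDiffAt 𝓘(ℝ, E) 𝓘(ℝ, ℝ) ∞ (fun y => η y (X y)) x := by
  have h := (hη x).clm_bundle_apply hX
  simp only [Bundle.contMDiffAt_totalSpace] at h
  exact h.2

theorem smooth_endField {φ : EndField E M} (hφ : SmoothEndField φ) {X : VField E M}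
    (hX : SmoothVField X) : SmoothVField (fun y => φ y (X y)) :=
  hφ.clm_bundle_apply hX

theorem diffAt_endField {φ : EndField E M} (hφ : SmoothEndField φ) {X : VField E M} {x : M}
    (hX : DiffAt X x) : DiffAt (fun y => φ y (X y)) x :=
  MDifferentiableAt.clm_bundle_apply ((hφ x).mdifferentiableAt (by simp)) hX

theorem bracket_congr {X X' Y Y' : VField E M} {x : M} (hX : X =ᶠ[nhds x] X')
    (hY : Y =ᶠ[nhds x] Y') : bracket X Y x = bracket X' Y' x :=
  hX.mlieBracket_vectorField_eq hY

theorem bracket_swap (X Y : VField E M) (x : M) : bracket X Y x = -bracket Y X x :=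
  VectorField.mlieBracket_swap_apply

theorem koszul_congr (g : Metric E M) {X X' Y Y' Z Z' : VField E M} {x : M}
    (hX : X =ᶠ[nhds x] X') (hY : Y =ᶠ[nhds x] Y') (hZ : Z =ᶠ[nhds x] Z') :
    koszul g X Y Z x = koszul g X' Y' Z' x := by
  have key : ∀ {U U' V V' : VField E M}, U =ᶠ[nhds x] U' → V =ᶠ[nhds x] V' →
      (fun y => g.inner y (U y) (V y)) =ᶠ[nhds x] fun y => g.inner y (U' y) (V' y) := by
    intro U U' V V' hU hV
    filter_upwards [hU, hV] with y h1 h2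
    rw [h1, h2]
  unfold koszul
  rw [dirDeriv_congr hX.self_of_nhds (key hY hZ), dirDeriv_congr hY.self_of_nhds (key hX hZ),
    dirDeriv_congr hZ.self_of_nhds (key hX hY), bracket_congr hX hY,
    bracket_congr hX hZ, bracket_congr hY hZ,
    hX.self_of_nhds, hY.self_of_nhds, hZ.self_of_nhds]

variable [FiniteDimensional ℝ E]

theorem bracket_smul_right (X : VField E M) {f : M → ℝ} {Y : VField E M} {x : M}
    (hf : MDifferentiableAt 𝓘(ℝ, E) 𝓘(ℝ, ℝ) f x) (hY : DiffAt Y x) :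
    bracket X (f • Y) x = dirDeriv X f x • Y x + f x • bracket X Y x := by
  have := FiniteDimensional.complete ℝ E
  exact VectorField.mlieBracket_smul_right hf hY

theorem bracket_add_right (X : VField E M) {Y Y' : VField E M} {x : M}
    (hY : DiffAt Y x) (hY' : DiffAt Y' x) :
    bracket X (Y + Y') x = bracket X Y x + bracket X Y' x := by
  have := FiniteDimensional.complete ℝ E
  exact VectorField.mlieBracket_add_right hY hY'

theorem smooth_bracket {X Y : VField E M} (hX : SmoothVField X) (hY : SmoothVField Y) :
    SmoothVField (bracket X Y) := by
  have := FiniteDimensional.complete ℝ E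
  have : IsManifold 𝓘(ℝ, E) (minSmoothness ℝ 2) M := by
    rw [minSmoothness_of_isRCLikeNormedField]
    exact .of_le (n := ∞) ENat.LEInfty.out
  have : IsManifold 𝓘(ℝ, E) (((⊤ : ℕ∞) : WithTop ℕ∞) + 1) M :=
    (inferInstance : IsManifold 𝓘(ℝ, E) ∞ M)
  exact ContDiff.mlieBracket_vectorField (m := ⊤) (n := ⊤) hX hY (by simp)

theorem bracket_leibniz {X Y Z : VField E M} (hX : SmoothVField X) (hY : SmoothVField Y)
    (hZ : SmoothVField Z) :
    bracket X (bracket Y Z) = bracket (bracket X Y) Z + bracket Y (bracket X Z) := by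
  have := FiniteDimensional.complete ℝ E
  have : IsManifold 𝓘(ℝ, E) (minSmoothness ℝ 3) M := by
    rw [minSmoothness_of_isRCLikeNormedField]
    exact .of_le (n := ∞) ENat.LEInfty.out
  refine VectorField.leibniz_identity_mlieBracket (hX.of_le ?_) (hY.of_le ?_) (hZ.of_le ?_) <;>
  · rw [minSmoothness_of_isRCLikeNormedField]
    exact ENat.LEInfty.out

theorem leviCivita_congr (g : Metric E M) {X X' Y Y' : VField E M} {x : M}
    (hX : X =ᶠ[nhds x] X') (hY : Y =ᶠ[nhds x] Y') :
    leviCivita g X Y x = leviCivita g X' Y' x := by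
  unfold leviCivita
  congr 1
  ext w
  exact koszul_congr g hX hY (Filter.EventuallyEq.refl _ _)

theorem leviCivita_eventuallyEq (g : Metric E M) {X X' Y Y' : VField E M} {x : M}
    (hX : X =ᶠ[nhds x] X') (hY : Y =ᶠ[nhds x] Y') :
    leviCivita g X Y =ᶠ[nhds x] leviCivita g X' Y' := by
  filter_upwards [hX.eventuallyEq_nhds, hY.eventuallyEq_nhds] with y h1 h2
  exact leviCivita_congr g h1 h2

theorem curvature_congr (g : Metric E M) {X X' Y Y' Z Z' : VField E M} {x : M}
    (hX : X =ᶠ[nhds x] X') (hY : Y =ᶠ[nhds x] Y') (hZ : Z =ᶠ[nhds x] Z') :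
    curvature g X Y Z x = curvature g X' Y' Z' x := by
  simp only [curvature, Pi.sub_apply]
  rw [leviCivita_congr g hX (leviCivita_eventuallyEq g hY hZ),
    leviCivita_congr g hY (leviCivita_eventuallyEq g hX hZ),
    leviCivita_congr g (hX.mlieBracket_vectorField hY) hZ]

/-- In Z, the derivative terms produced by X(f), Y(f) cancel against those of [X, fZ], [Y, fZ].
Hence the connection, defined by testing on the particular extensions `ext w`, satisfies the Koszul
formula against every Z. -/
theorem koszul_tensorialAt (g : Metric E M) {X Y : VField E M} {x : M}
    (hX : DiffAt X x) (hY : DiffAt Y x) :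
    TensorialAt 𝓘(ℝ, E) E (fun Z : VField E M => koszul g X Y Z x) x where
  smul {f Z} hf hZ := by
    have h : ∀ U : VField E M, (fun y => g.inner y (U y) ((f • Z) y)) =
        f * fun y => g.inner y (U y) (Z y) := by
      intro U; ext y; simp
    simp only [koszul, h]
    rw [dirDeriv_mul X hf (mdifferentiableAt_inner g hY hZ),
      dirDeriv_mul Y hf (mdifferentiableAt_inner g hX hZ), dirDeriv_smul_left,
      bracket_smul_right X hf hZ, bracket_smul_right Y hf hZ]
    simp only [Pi.smul_apply', map_smul, map_add, add_apply,
      smul_apply, smul_eq_mul]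
    rw [g.symm x (Z x), g.symm x (Z x)]
    ring
  add {Z Z'} hZ hZ' := by
    have h : ∀ U : VField E M, (fun y => g.inner y (U y) ((Z + Z') y)) =
        (fun y => g.inner y (U y) (Z y)) + fun y => g.inner y (U y) (Z' y) := by
      intro U; ext y; simp
    simp only [koszul, h]
    rw [dirDeriv_add X (mdifferentiableAt_inner g hY hZ) (mdifferentiableAt_inner g hY hZ'),
      dirDeriv_add Y (mdifferentiableAt_inner g hX hZ) (mdifferentiableAt_inner g hX hZ'),
      dirDeriv_add_left, bracket_add_right X hZ hZ', bracket_add_right Y hZ hZ']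
    simp only [Pi.add_apply, map_add, add_apply]
    ring

theorem inner_leviCivita (g : Metric E M) {X Y Z : VField E M} {x : M}
    (hX : DiffAt X x) (hY : DiffAt Y x) (hZ : DiffAt Z x) :
    g.inner x (leviCivita g X Y x) (Z x) = koszul g X Y Z x := by
  have hT := koszul_tensorialAt g hX hY
  have h := inner_sharp g x (TensorialAt.mkHom _ x hT) (Z x)
  exact h.trans (TensorialAt.mkHom_apply hT hZ)

end Pointwise

/-! ### The Lie ring and module of smooth vector fields -/

section Global

variable (E : Type*) [NormedAddCommGroup E] [NormedSpace ℝ E]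
  (M : Type*) [TopologicalSpace M] [ChartedSpace E M]

/-- The ring of smooth real functions. -/
abbrev Fun : Type _ := C^∞⟮𝓘(ℝ, E), M; 𝓘(ℝ, ℝ), ℝ⟯

variable [IsManifold 𝓘(ℝ, E) ∞ M]

/-- The additive group of smooth vector fields. -/
def smoothFields : AddSubgroup (VField E M) where
  carrier := {X | SmoothVField X}
  zero_mem' := Bundle.contMDiff_zeroSection ℝ (fun x : M => TangentSpace 𝓘(ℝ, E) x)
  add_mem' hX hY := ContMDiff.add_section hX hY
  neg_mem' hX := ContMDiff.neg_section hX

/-- Smooth vector fields. -/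
abbrev Fields : Type _ := smoothFields E M

variable {E M}

theorem Fields.diffAt (X : Fields E M) (x : M) : DiffAt (X : VField E M) x := X.2.diffAt x

theorem Fields.ext' {X Y : Fields E M} (h : ∀ x, X.1 x = Y.1 x) : X = Y := Subtype.ext (funext h)

theorem Fun.diffAt (f : Fun E M) (x : M) : MDifferentiableAt 𝓘(ℝ, E) 𝓘(ℝ, ℝ) f x :=
  (f.contMDiff x).mdifferentiableAt (by simp)

instance : Module (Fun E M) (Fields E M) where
  smul f X := ⟨(f : M → ℝ) • X.1, ContMDiff.smul_section f.contMDiff X.2⟩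
  one_smul X := Fields.ext' fun x => one_smul ℝ (X.1 x)
  mul_smul f h X := Fields.ext' fun x => mul_smul (f x) (h x) (X.1 x)
  smul_zero f := Fields.ext' fun x => smul_zero (f x)
  smul_add f X Y := Fields.ext' fun x => smul_add (f x) (X.1 x) (Y.1 x)
  add_smul f h X := Fields.ext' fun x => add_smul (f x) (h x) (X.1 x)
  zero_smul X := Fields.ext' fun x => zero_smul ℝ (X.1 x)

@[simp] theorem Fields.smul_apply (f : Fun E M) (X : Fields E M) (x : M) :
    (f • X).1 x = f x • X.1 x := rfl

@[simp] theorem Fields.add_apply (X Y : Fields E M) (x : M) : (X + Y).1 x = X.1 x + Y.1 x := rfl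

@[simp] theorem Fields.sum_apply {ι : Type*} (s : Finset ι) (X : ι → Fields E M) (x : M) :
    (∑ i ∈ s, X i).1 x = ∑ i ∈ s, (X i).1 x := by
  rw [AddSubgroup.val_finsetSum, Finset.sum_apply]

@[simp] theorem Fun.sum_apply {ι : Type*} (s : Finset ι) (f : ι → Fun E M) (x : M) :
    (∑ i ∈ s, f i) x = ∑ i ∈ s, f i x := by
  exact map_sum (ContMDiffMap.evalRingHom (I := 𝓘(ℝ, E)) (I' := 𝓘(ℝ, ℝ)) (n := ∞) x) f s

variable [FiniteDimensional ℝ E]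

instance : LieRing (Fields E M) where
  bracket X Y := ⟨bracket X.1 Y.1, smooth_bracket X.2 Y.2⟩
  add_lie X Y Z := Fields.ext' fun x => by
    change bracket (X.1 + Y.1) Z.1 x = bracket X.1 Z.1 x + bracket Y.1 Z.1 x
    rw [bracket_swap, bracket_add_right _ (X.diffAt x) (Y.diffAt x), bracket_swap X.1,
      bracket_swap Y.1, neg_add]
  lie_add X Y Z := Fields.ext' fun x => bracket_add_right _ (Y.diffAt x) (Z.diffAt x)
  lie_self X := Fields.ext' fun x => congrFun VectorField.mlieBracket_self x
  leibniz_lie X Y Z := Subtype.ext (bracket_leibniz X.2 Y.2 Z.2)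

/-- The derivation of functions defined by a smooth vector field. -/
def Fields.deriv (X : Fields E M) : Derivation ℝ (Fun E M) (Fun E M) :=
  Derivation.mk'
    { toFun := fun f => ⟨dirDeriv X.1 f, smooth_dirDeriv X.2 f.contMDiff⟩
      map_add' := fun f h => ContMDiffMap.ext fun x => dirDeriv_add _ (f.diffAt x) (h.diffAt x)
      map_smul' := fun c f => ContMDiffMap.ext fun x => by
        have := dirDeriv_mul X.1 (f := fun _ => c) mdifferentiableAt_const (f.diffAt x)
        rw [dirDeriv_const, mul_zero, add_zero] at this
        exact this }
    fun f h => ContMDiffMap.ext fun x => dirDeriv_mul _ (f.diffAt x) (h.diffAt x)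

theorem Fields.deriv_apply (X : Fields E M) (f : Fun E M) (x : M) :
    X.deriv f x = dirDeriv X.1 f x := rfl

theorem Fields.lie_smul (X Y : Fields E M) (f : Fun E M) :
    ⁅X, f • Y⁆ = X.deriv f • Y + f • ⁅X, Y⁆ :=
  Fields.ext' fun x => bracket_smul_right X.1 (f.diffAt x) (Y.diffAt x)

end Global

/-! ### Cut-off functions and frames -/

section Frame

variable {E : Type*} [NormedAddCommGroup E] [NormedSpace ℝ E]
  {M : Type*} [TopologicalSpace M] [ChartedSpace E M] [IsManifold 𝓘(ℝ, E) ∞ M]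
  [FiniteDimensional ℝ E]

/-- The frame of the tangent bundle near `x` given by the preferred trivialization at `x`. -/
def chartFrame (x : M) (i : Fin (Module.finrank ℝ E)) : VField E M :=
  (trivializationAt E (TangentSpace 𝓘(ℝ, E)) x).localFrame (Module.finBasis ℝ E) i

/-- A globally defined frame, cut off, which is the preferred frame near `x`. -/
structure FrameAt (x : M) extends
    CutoffFrame (Fun E M) (Fields E M) (Fin (Module.finrank ℝ E)) where
  θ_zero : ∀ i (X : Fields E M) y, X.1 y = 0 → θ i X y = 0
  ρ_one : ∀ᶠ y in nhds x, ρ y = 1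
  e_eq : ∀ᶠ y in nhds x, ∀ i, (e i).1 y = chartFrame x i y

theorem exists_cutoff [T2Space M] {x : M} {u : Set M} (hu : u ∈ nhds x) :
    ∃ ψ : Fun E M, tsupport ψ ⊆ u ∧ ∀ᶠ y in nhds x, ψ y = 1 := by
  obtain ⟨f, hf⟩ := (SmoothBumpFunction.nhds_basis_support (I := 𝓘(ℝ, E)) hu).ex_mem
  exact ⟨⟨f, f.contMDiff⟩, hf, f.eventuallyEq_one⟩

/-- A local section multiplied by a cut-off function. -/
theorem smooth_cutoff {X : VField E M} {u : Set M} (hu : IsOpen u) (ψ : Fun E M)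
    (hψ : tsupport ψ ⊆ u) (hX : CMDiff[u] ∞ (T% X)) : SmoothVField ((ψ : M → ℝ) • X) :=
  ContMDiffOn.smul_section_of_tsupport ψ.contMDiff.contMDiffOn hu hψ hX

theorem exists_fields_eventuallyEq_ext [T2Space M] {x : M} (v : TangentSpace 𝓘(ℝ, E) x) :
    ∃ X : Fields E M, X.1 =ᶠ[nhds x] ext v := by
  obtain ⟨s, hs, hX⟩ := FiberBundle.exists_contMDiffOn_extend (k := ∞) 𝓘(ℝ, E) E v
  obtain ⟨ψ, hψ, h1⟩ := exists_cutoff (E := E) (interior_mem_nhds.2 hs)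
  refine ⟨⟨_, smooth_cutoff isOpen_interior ψ hψ (hX.mono interior_subset)⟩, ?_⟩
  filter_upwards [h1] with y hy
  change ψ y • ext v y = ext v y
  rw [hy, one_smul]

theorem exists_fields_apply_eq [T2Space M] {x : M} (v : TangentSpace 𝓘(ℝ, E) x) :
    ∃ X : Fields E M, X.1 x = v := by
  obtain ⟨X, hX⟩ := exists_fields_eventuallyEq_ext v
  exact ⟨X, hX.self_of_nhds.trans (ext_self v)⟩

/-- Two nested cut-offs: ψ₁ makes the frame global, and ψ, supported where ψ₁ = 1, makes the coframe
global. On the support of ψ the frame is therefore uncut, and both frame identities hold with ρ = ψ.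
-/
theorem nonempty_frameAt [T2Space M] (x : M) : Nonempty (FrameAt (E := E) x) := by
  set t := trivializationAt E (TangentSpace 𝓘(ℝ, E)) x with ht
  have hx : x ∈ t.baseSet := FiberBundle.mem_baseSet_trivializationAt' x
  let b := Module.finBasis ℝ E
  obtain ⟨ψ₁, h₁, h₁'⟩ := exists_cutoff (E := E) (t.open_baseSet.mem_nhds hx)
  obtain ⟨V, hV, hVo, hxV⟩ := eventually_nhds_iff.1 h₁'
  obtain ⟨ψ, h₂, h₂'⟩ := exists_cutoff (E := E) ((hVo.inter t.open_baseSet).mem_nhds ⟨hxV, hx⟩)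
  have hsm : ∀ i, CMDiff[t.baseSet] ∞ (T% (t.localFrame b i)) :=
    fun i => t.contMDiffOn_localFrame_baseSet ∞ b i
  have hψ : ∀ y, ψ y ≠ 0 → ψ₁ y = 1 ∧ y ∈ t.baseSet := fun y hy =>
    ⟨hV y (h₂ (subset_tsupport _ hy)).1, (h₂ (subset_tsupport _ hy)).2⟩
  have hco : ∀ i (X : Fields E M), ContMDiff 𝓘(ℝ, E) 𝓘(ℝ, ℝ) ∞
      (fun y => ψ y * t.localFrameCoeff 𝓘(ℝ, E) b i y (X.1 y)) := by
    intro i X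
    refine contMDiff_of_tsupport fun y hy => ?_
    have hy : y ∈ t.baseSet := (h₂ (closure_mono (fun z hz => left_ne_zero_of_mul hz) hy)).2
    exact (ψ.contMDiff y).mul (contMDiffAt_localFrameCoeff b hy (X.2 y) i)
  exact ⟨{
    e := fun i => ⟨(ψ₁ : M → ℝ) • t.localFrame b i,
      smooth_cutoff t.open_baseSet ψ₁ h₁ (hsm i)⟩
    θ := fun i =>
      { toFun := fun X => ⟨fun y => ψ y * t.localFrameCoeff 𝓘(ℝ, E) b i y (X.1 y), hco i X⟩
        map_add' := fun X Y => ContMDiffMap.ext fun y => by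
          change ψ y * _ = ψ y * _ + ψ y * _
          rw [Fields.add_apply, map_add, mul_add]
        map_smul' := fun f X => ContMDiffMap.ext fun y => by
          change ψ y * _ = f y * (ψ y * _)
          rw [Fields.smul_apply, map_smul, smul_eq_mul, mul_left_comm] }
    ρ := ψ
    sum_eq := fun X => Fields.ext' fun y => by
      rw [Fields.sum_apply, Fields.smul_apply]
      change ∑ i, (ψ y * t.localFrameCoeff 𝓘(ℝ, E) b i y (X.1 y)) • (ψ₁ y • t.localFrame b i y) = _
      rcases eq_or_ne (ψ y) 0 with h | h
      · simp [h]
      · obtain ⟨ha, hb⟩ := hψ y h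
        simp only [ha, one_smul, mul_smul, ← Finset.smul_sum]
        rw [← t.eq_sum_localFrameCoeff_smul (s := X.1) hb]
    dual := fun i j => ContMDiffMap.ext fun y => by
      change ψ y * t.localFrameCoeff 𝓘(ℝ, E) b i y (ψ₁ y • t.localFrame b j y) = _
      rcases eq_or_ne (ψ y) 0 with h | h
      · rw [h, zero_mul]; split_ifs
        · exact h.symm
        · rfl
      · obtain ⟨ha, hb⟩ := hψ y h
        rw [ha, one_smul, t.localFrameCoeff_apply_of_mem_baseSet b hb,
          t.localFrame_apply_of_mem_baseSet b hb, Module.Basis.repr_self,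
          Finsupp.single_apply]
        simp only [eq_comm (a := j)]
        split_ifs
        · rw [mul_one]
        · rw [mul_zero]; rfl
    θ_zero := fun i X y h => by
      change ψ y * t.localFrameCoeff 𝓘(ℝ, E) b i y (X.1 y) = 0
      rw [h, map_zero, mul_zero]
    ρ_one := h₂'
    e_eq := by
      filter_upwards [h₁'] with y hy i
      change ψ₁ y • chartFrame x i y = chartFrame x i y
      rw [hy, one_smul] }⟩

end Frame

/-! ### Smoothness of the connection; the Lie-Rinehart structure -/

section LeviCivita

variable {E : Type*} [NormedAddCommGroup E] [NormedSpace ℝ E]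
  {M : Type*} [TopologicalSpace M] [ChartedSpace E M] [IsManifold 𝓘(ℝ, E) ∞ M]

theorem contMDiffAt_det {ι : Type*} [Fintype ι] [DecidableEq ι] {A : M → Matrix ι ι ℝ} {x : M}
    (hA : ∀ i j, ContMDiffAt 𝓘(ℝ, E) 𝓘(ℝ, ℝ) ∞ (fun y => A y i j) x) :
    ContMDiffAt 𝓘(ℝ, E) 𝓘(ℝ, ℝ) ∞ (fun y => (A y).det) x := by
  simp only [Matrix.det_apply']
  refine ContMDiffAt.sum fun σ _ => contMDiffAt_const.mul ?_
  exact ContMDiffAt.prod fun i _ => hA _ _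

theorem contMDiffAt_matrix_inv {ι : Type*} [Fintype ι] [DecidableEq ι] {A : M → Matrix ι ι ℝ}
    {x : M} (hA : ∀ i j, ContMDiffAt 𝓘(ℝ, E) 𝓘(ℝ, ℝ) ∞ (fun y => A y i j) x)
    (hdet : (A x).det ≠ 0) (i j : ι) :
    ContMDiffAt 𝓘(ℝ, E) 𝓘(ℝ, ℝ) ∞ (fun y => (A y)⁻¹ i j) x := by
  simp only [Matrix.inv_def, Matrix.smul_apply, Ring.inverse_eq_inv', smul_eq_mul,
    Matrix.adjugate_apply]
  refine ((contMDiffAt_det hA).inv₀ hdet).mul (contMDiffAt_det fun k l => ?_)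
  simp only [Matrix.updateRow_apply]
  split_ifs
  · exact contMDiffAt_const
  · exact hA k l

variable [FiniteDimensional ℝ E]

theorem inner_eq_zero (g : Metric E M) {x : M} {v : TangentSpace 𝓘(ℝ, E) x}
    (h : g.inner x v v = 0) : v = 0 := by
  by_contra hv
  exact (g.pos x v hv).ne' h

theorem FrameAt.linearIndependent {x : M} (F : FrameAt (E := E) x) :
    ∀ᶠ y in nhds x, LinearIndependent ℝ fun i => (F.e i).1 y := by
  filter_upwards [F.e_eq, (trivializationAt E (TangentSpace 𝓘(ℝ, E)) x).open_baseSet.mem_nhds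
    (FiberBundle.mem_baseSet_trivializationAt' x)] with y hy hyb
  simp only [hy]
  exact ((trivializationAt E (TangentSpace 𝓘(ℝ, E)) x).isLocalFrameOn_localFrame_baseSet
    𝓘(ℝ, E) 1 (Module.finBasis ℝ E)).linearIndependent hyb

variable [T2Space M]

theorem FrameAt.exists_eq_sum {x : M} (F : FrameAt (E := E) x) {y : M} (hy : F.ρ y = 1)
    (v : TangentSpace 𝓘(ℝ, E) y) : ∃ c : Fin (Module.finrank ℝ E) → ℝ, v = ∑ i, c i • (F.e i).1 y := by
  obtain ⟨X, rfl⟩ := exists_fields_apply_eq (E := E) v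
  refine ⟨fun i => F.θ i X y, ?_⟩
  have := congrArg (fun Y : Fields E M => Y.1 y) (F.sum_eq X)
  simp only [Fields.sum_apply, Fields.smul_apply, hy, one_smul] at this
  exact this.symm

/-- In a smooth local frame, the coefficients of V are the inverse Gram matrix applied to its inner
products with the frame, and the inverse is smooth by Cramer's rule. -/
theorem smooth_of_inner (g : Metric E M) {V : VField E M}
    (hV : ∀ W : Fields E M, ContMDiff 𝓘(ℝ, E) 𝓘(ℝ, ℝ) ∞ fun y => g.inner y (V y) (W.1 y)) :
    SmoothVField V := by
  intro x
  obtain ⟨F⟩ := nonempty_frameAt (E := E) x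
  let G : M → Matrix (Fin (Module.finrank ℝ E)) (Fin (Module.finrank ℝ E)) ℝ :=
    fun y => Matrix.of fun i j => g.inner y ((F.e i).1 y) ((F.e j).1 y)
  have hG : ∀ i j, ContMDiffAt 𝓘(ℝ, E) 𝓘(ℝ, ℝ) ∞ (fun y => G y i j) x :=
    fun i j => contMDiffAt_inner g ((F.e i).2 x) ((F.e j).2 x)
  have hdet : ∀ᶠ y in nhds x, (G y).det ≠ 0 := by
    filter_upwards [F.linearIndependent] with y hy h
    obtain ⟨c, hc, h0⟩ := Matrix.exists_mulVec_eq_zero_iff.2 h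
    have hz : ∀ i, g.inner y ((F.e i).1 y) (∑ j, c j • (F.e j).1 y) = 0 := by
      intro i
      have := congrFun h0 i
      simp only [Matrix.mulVec, dotProduct, G, Matrix.of_apply, Pi.zero_apply] at this
      rw [map_sum, ← this]
      refine Finset.sum_congr rfl fun j _ => ?_
      rw [map_smul, smul_eq_mul, mul_comm]
    have h1 : ∑ j, c j • (F.e j).1 y = 0 := by
      refine inner_eq_zero g ?_
      rw [map_sum]
      refine Finset.sum_eq_zero fun j _ => ?_
      rw [map_smul, g.symm, hz, smul_zero]
    exact hc (funext (Fintype.linearIndependent_iff.1 hy c h1))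
  have hcoef : ∀ i j, ContMDiffAt 𝓘(ℝ, E) 𝓘(ℝ, ℝ) ∞
      (fun y => (G y)⁻¹ i j * g.inner y (V y) ((F.e j).1 y)) x := fun i j =>
    (contMDiffAt_matrix_inv hG hdet.self_of_nhds i j).mul (hV (F.e j) x)
  have hsum : CMDiffAt ∞ (T% (fun y => ∑ i, (fun y => ∑ j, (G y)⁻¹ i j *
      g.inner y (V y) ((F.e j).1 y)) y • (F.e i).1 y)) x :=
    ContMDiffAt.sum_section fun i _ => ContMDiffAt.smul_section
      (ContMDiffAt.sum fun j _ => hcoef i j) ((F.e i).2 x)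
  refine hsum.congr_of_eventuallyEq ?_
  filter_upwards [hdet, F.ρ_one] with y hy hρ
  congr 1
  obtain ⟨c, hc⟩ := F.exists_eq_sum hρ (V y)
  have h1 : ∀ j, g.inner y (V y) ((F.e j).1 y) = ∑ k, G y j k * c k := by
    intro j
    rw [g.symm, hc, map_sum]
    refine Finset.sum_congr rfl fun k _ => ?_
    rw [map_smul, smul_eq_mul, mul_comm]; rfl
  have h2 : ∀ i, ∑ j, (G y)⁻¹ i j * g.inner y (V y) ((F.e j).1 y) = c i := by
    intro i
    have := congrFun (Matrix.mulVec_mulVec c (G y)⁻¹ (G y)) i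
    rw [Matrix.nonsing_inv_mul _ (isUnit_iff_ne_zero.2 hy), Matrix.one_mulVec] at this
    simp only [h1]
    exact this
  simp only [h2]
  exact hc

theorem smooth_leviCivita (g : Metric E M) {X Y : VField E M} (hX : SmoothVField X)
    (hY : SmoothVField Y) : SmoothVField (leviCivita g X Y) := by
  refine smooth_of_inner g fun W => ?_
  have h : (fun y => g.inner y (leviCivita g X Y y) (W.1 y)) = koszul g X Y W.1 :=
    funext fun y => inner_leviCivita g (hX.diffAt y) (hY.diffAt y) (W.diffAt y)
  rw [h]
  have hi : ∀ {U V : VField E M}, SmoothVField U → SmoothVField V →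
      ContMDiff 𝓘(ℝ, E) 𝓘(ℝ, ℝ) ∞ fun y => g.inner y (U y) (V y) :=
    fun hU hV y => contMDiffAt_inner g (hU y) (hV y)
  exact contMDiff_const.mul ((((((smooth_dirDeriv hX (hi hY W.2)).add
    (smooth_dirDeriv hY (hi hX W.2))).sub (smooth_dirDeriv W.2 (hi hX hY))).add
    (hi (smooth_bracket hX hY) W.2)).sub (hi (smooth_bracket hX W.2) hY)).sub
    (hi (smooth_bracket hY W.2) hX))

/-- Expanding the Jacobi identity for X, Y and fW shows that the defect function annihilates every
field W. -/
theorem Fields.deriv_lie (X Y : Fields E M) (f : Fun E M) :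
    (⁅X, Y⁆).deriv f = X.deriv (Y.deriv f) - Y.deriv (X.deriv f) := by
  have key : ∀ W : Fields E M,
      ((⁅X, Y⁆).deriv f - (X.deriv (Y.deriv f) - Y.deriv (X.deriv f))) • W = 0 := by
    intro W
    have h := leibniz_lie X Y (f • W)
    simp only [Fields.lie_smul, lie_add] at h
    rw [leibniz_lie X Y W] at h
    rw [← sub_eq_zero] at h
    rw [← neg_eq_zero, ← h]
    module
  refine ContMDiffMap.ext fun x => ?_
  by_contra hne
  -- A nonzero defect at x would make all smooth fields vanish at x. Then every derivative at x is
  -- zero, and so is the defect.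
  have h0 : ∀ W : Fields E M, W.1 x = 0 := fun W =>
    (smul_eq_zero.1 (congrArg (fun V : Fields E M => V.1 x) (key W))).resolve_left
      (sub_ne_zero.2 hne)
  have hd : ∀ (W : Fields E M) (h : Fun E M), W.deriv h x = 0 := fun W h => by
    rw [Fields.deriv_apply, dirDeriv, h0 W, map_zero]
  refine hne ((hd _ _).trans ?_)
  change 0 = X.deriv (Y.deriv f) x - Y.deriv (X.deriv f) x
  rw [hd, hd, sub_zero]

/-- The metric as a bilinear form on smooth vector fields. -/
def innerHom (g : Metric E M) : Fields E M →ₗ[Fun E M] Fields E M →ₗ[Fun E M] Fun E M :=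
  LinearMap.mk₂ (Fun E M)
    (fun X Y => ⟨fun y => g.inner y (X.1 y) (Y.1 y), fun y => contMDiffAt_inner g (X.2 y) (Y.2 y)⟩)
    (fun X X' Y => ContMDiffMap.ext fun y => by
      change g.inner y (X.1 y + X'.1 y) (Y.1 y) = _
      rw [map_add]; rfl)
    (fun f X Y => ContMDiffMap.ext fun y => by
      change g.inner y (f y • X.1 y) (Y.1 y) = _
      rw [map_smul]; rfl)
    (fun X Y Y' => ContMDiffMap.ext fun y => map_add (g.inner y (X.1 y)) _ _)
    (fun f X Y => ContMDiffMap.ext fun y => map_smul (g.inner y (X.1 y)) _ _)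

/-- The Lie-Rinehart pair of smooth functions and smooth vector fields, with a metric. -/
def lieRinehart (g : Metric E M) : MetricLieRinehart (Fun E M) (Fields E M) where
  D :=
    { toFun := Fields.deriv
      map_add' := fun X Y => Derivation.ext fun f => ContMDiffMap.ext fun x =>
        dirDeriv_add_left X.1 Y.1 f x
      map_smul' := fun h X => Derivation.ext fun f => ContMDiffMap.ext fun x =>
        dirDeriv_smul_left h X.1 f x }
  D_lie := Fields.deriv_lie
  lie_smul := Fields.lie_smul
  g := innerHom g
  symm X Y := ContMDiffMap.ext fun y => g.symm y _ _
  nondeg X h := Fields.ext' fun y => inner_eq_zero g (congrArg (fun f : Fun E M => f y) (h X))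
  nabla X Y := ⟨leviCivita g X.1 Y.1, smooth_leviCivita g X.2 Y.2⟩
  koszul X Y Z := ContMDiffMap.ext fun y => by
    have := inner_leviCivita g (X.diffAt y) (Y.diffAt y) (Z.diffAt y)
    unfold koszul at this
    rw [two_mul]
    change g.inner y (leviCivita g X.1 Y.1 y) (Z.1 y) +
        g.inner y (leviCivita g X.1 Y.1 y) (Z.1 y) =
      dirDeriv X.1 (fun y => g.inner y (Y.1 y) (Z.1 y)) y
      + dirDeriv Y.1 (fun y => g.inner y (X.1 y) (Z.1 y)) y
      - dirDeriv Z.1 (fun y => g.inner y (X.1 y) (Y.1 y)) y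
      + g.inner y (bracket X.1 Y.1 y) (Z.1 y)
      - g.inner y (bracket X.1 Z.1 y) (Y.1 y)
      - g.inner y (bracket Y.1 Z.1 y) (X.1 y)
    rw [this]; ring

end LeviCivita

/-! ### Comparison of pointwise and algebraic curvature -/

section Ricci

variable {E : Type*} [NormedAddCommGroup E] [NormedSpace ℝ E]
  {M : Type*} [TopologicalSpace M] [ChartedSpace E M] [IsManifold 𝓘(ℝ, E) ∞ M]
  [FiniteDimensional ℝ E] [T2Space M]

theorem lieRinehart_D_apply (g : Metric E M) (X : Fields E M) (f : Fun E M) (x : M) :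
    (lieRinehart g).D X f x = dirDeriv X.1 f x := rfl

theorem lieRinehart_R_apply (g : Metric E M) (X Y Z : Fields E M) (x : M) :
    ((lieRinehart g).R X Y Z).1 x = curvature g X.1 Y.1 Z.1 x := rfl

/-- A linear map over smooth functions is determined at a point by the value of its argument. -/
theorem apply_eq_zero {T : Fields E M →ₗ[Fun E M] Fields E M} {X : Fields E M} {x : M}
    (hX : X.1 x = 0) : (T X).1 x = 0 := by
  obtain ⟨F⟩ := nonempty_frameAt (E := E) x
  have h := congrArg (fun Y : Fields E M => (T Y).1 x) (F.sum_eq X)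
  simp only [map_sum, map_smul, Fields.sum_apply, Fields.smul_apply, F.θ_zero _ X x hX, zero_smul,
    Finset.sum_const_zero, F.ρ_one.self_of_nhds, one_smul] at h
  exact h.symm

theorem apply_congr (T : Fields E M →ₗ[Fun E M] Fields E M) {X X' : Fields E M} {x : M}
    (hX : X.1 x = X'.1 x) : (T X).1 x = (T X').1 x := by
  have h := apply_eq_zero (T := T) (X := X - X') (sub_eq_zero.2 hX : X.1 x - X'.1 x = 0)
  rw [map_sub] at h
  exact sub_eq_zero.1 h

theorem R_apply_congr (g : Metric E M) {X X' Y Y' Z Z' : Fields E M} {x : M}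
    (hX : X.1 x = X'.1 x) (hY : Y.1 x = Y'.1 x) (hZ : Z.1 x = Z'.1 x) :
    ((lieRinehart g).R X Y Z).1 x = ((lieRinehart g).R X' Y' Z').1 x := by
  have h1 := apply_congr (((lieRinehart g).RHom.flip Y).flip Z) hX
  have h2 := apply_congr (((lieRinehart g).RHom X').flip Z) hY
  have h3 := apply_congr ((lieRinehart g).RHom X' Y') hZ
  exact (h1.trans h2).trans h3

/-- The extensions `ext` are smooth only near x. Global fields with the same germs replace them, and
tensoriality then allows any fields with the same values at x. -/
theorem curvature_ext (g : Metric E M) (X Y Z : Fields E M) (x : M) :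
    curvature g (ext (X.1 x)) (ext (Y.1 x)) (ext (Z.1 x)) x = ((lieRinehart g).R X Y Z).1 x := by
  obtain ⟨X', hX⟩ := exists_fields_eventuallyEq_ext (X.1 x)
  obtain ⟨Y', hY⟩ := exists_fields_eventuallyEq_ext (Y.1 x)
  obtain ⟨Z', hZ⟩ := exists_fields_eventuallyEq_ext (Z.1 x)
  rw [← curvature_congr g hX hY hZ, ← lieRinehart_R_apply]
  exact R_apply_congr g (hX.self_of_nhds.trans (ext_self _)) (hY.self_of_nhds.trans (ext_self _))
    (hZ.self_of_nhds.trans (ext_self _))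

theorem FrameAt.θ_congr {x y : M} (F : FrameAt (E := E) x) (i : Fin (Module.finrank ℝ E))
    {X X' : Fields E M} (h : X.1 y = X'.1 y) : F.θ i X y = F.θ i X' y := by
  have := F.θ_zero i (X - X') y (sub_eq_zero.2 h : X.1 y - X'.1 y = 0)
  rw [map_sub] at this
  exact sub_eq_zero.1 this

/-- Basis independence of the trace, comparing the fixed basis at y with the frame. It is needed at
all y with ρ = 1, not only at x, since the resulting identity is later differentiated. -/
theorem ricci_eq_ric (g : Metric E M) {x : M} (F : FrameAt (E := E) x) {y : M} (hy : F.ρ y = 1)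
    (X Y : Fields E M) :
    ricci g y (X.1 y) (Y.1 y) = (lieRinehart g).ric F.toCutoffFrame X Y y := by
  choose b hb using fun i => exists_fields_apply_eq (E := E) (tangentBasis (E := E) y i)
  have h1 : ∀ k, ((lieRinehart g).R (b k) X Y).1 y =
      ∑ i, F.θ i (b k) y • ((lieRinehart g).R (F.e i) X Y).1 y := by
    intro k
    have h := congrArg (fun U : Fields E M => ((lieRinehart g).RHom U X Y).1 y) (F.sum_eq (b k))
    simp only [map_sum, map_smul, LinearMap.sum_apply, LinearMap.smul_apply, Fields.sum_apply,
      Fields.smul_apply, hy, one_smul] at h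
    exact h.symm
  have h2 : ∀ V : Fields E M, ∀ i,
      F.θ i V y = ∑ k, (tangentBasis (E := E) y).coord k (V.1 y) * F.θ i (b k) y := by
    intro V i
    have h : V.1 y = (∑ k, algebraMap ℝ (Fun E M) ((tangentBasis (E := E) y).coord k (V.1 y)) •
        b k : Fields E M).1 y := by
      rw [Fields.sum_apply]
      conv_lhs => rw [← (tangentBasis (E := E) y).sum_repr (V.1 y)]
      refine Finset.sum_congr rfl fun k _ => ?_
      rw [Fields.smul_apply, hb]; rfl
    rw [F.θ_congr i h, map_sum, Fun.sum_apply]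
    refine Finset.sum_congr rfl fun k _ => ?_
    rw [map_smul]; rfl
  rw [MetricLieRinehart.ric, Fun.sum_apply,
    Finset.sum_congr rfl fun i _ => h2 _ i, ricci]
  rw [Finset.sum_comm]
  refine Finset.sum_congr rfl fun k _ => ?_
  rw [← hb k, curvature_ext, h1, map_sum]
  refine Finset.sum_congr rfl fun i _ => ?_
  rw [map_smul, smul_eq_mul, mul_comm]

/-- The Ricci tensor at a point is linear in its second argument. -/
theorem inner_ricciOp (g : Metric E M) (x : M) (v w : TangentSpace 𝓘(ℝ, E) x) :
    g.inner x (ricciOp g x v) w = ricci g x v w := by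
  obtain ⟨F⟩ := nonempty_frameAt (E := E) x
  have hρ := F.ρ_one.self_of_nhds
  obtain ⟨X, rfl⟩ := exists_fields_apply_eq (E := E) v
  let ℓ : TangentSpace 𝓘(ℝ, E) x →ₗ[ℝ] ℝ :=
    { toFun := ricci g x (X.1 x)
      map_add' := fun v w => by
        obtain ⟨V, rfl⟩ := exists_fields_apply_eq (E := E) v
        obtain ⟨W, rfl⟩ := exists_fields_apply_eq (E := E) w
        rw [← Fields.add_apply, ricci_eq_ric g F hρ, ricci_eq_ric g F hρ, ricci_eq_ric g F hρ]
        simp only [MetricLieRinehart.ric, MetricLieRinehart.R_add₃, map_add, Fun.sum_apply,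
          ← Finset.sum_add_distrib]
        rfl
      map_smul' := fun c v => by
        obtain ⟨V, rfl⟩ := exists_fields_apply_eq (E := E) v
        have h : c • V.1 x = (algebraMap ℝ (Fun E M) c • V).1 x := rfl
        rw [h, ricci_eq_ric g F hρ, ricci_eq_ric g F hρ]
        simp only [MetricLieRinehart.ric, MetricLieRinehart.R_smul₃, map_smul, Fun.sum_apply,
          RingHom.id_apply, smul_eq_mul, Finset.mul_sum]
        rfl }
  exact inner_sharp g x ℓ w

theorem IsInfinitesimalIsometry.isKilling {g : Metric E M} {Z : VField E M}
    (hZ : IsInfinitesimalIsometry g Z) : (lieRinehart g).IsKilling ⟨Z, hZ.1⟩ := fun X Y =>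
  ContMDiffMap.ext fun x => by
    have := hZ.2 x X.1 Y.1 (X.diffAt x) (Y.diffAt x)
    change dirDeriv Z (fun y => g.inner y (X.1 y) (Y.1 y)) x =
      g.inner x (bracket Z X.1 x) (Y.1 x) + g.inner x (X.1 x) (bracket Z Y.1 x)
    linear_combination this

/-- The algebraic K-contact structure of a K-contact manifold. -/
def ContactMetricStructure.kContact {n : ℕ} (S : ContactMetricStructure E M n)
    (hK : S.IsKContact) : (lieRinehart S.g).KContact where
  η :=
    { toFun := fun X => ⟨fun y => S.η y (X.1 y),
        fun y => contMDiffAt_oneForm S.contact.1 (X.2 y)⟩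
      map_add' := fun _ _ => ContMDiffMap.ext fun y => map_add (S.η y) _ _
      map_smul' := fun _ _ => ContMDiffMap.ext fun y => map_smul (S.η y) _ _ }
  ξ := ⟨S.ξ, S.smooth_ξ⟩
  φ :=
    { toFun := fun X => ⟨fun y => S.φ y (X.1 y), smooth_endField S.smooth_φ X.2⟩
      map_add' := fun _ _ => Fields.ext' fun y => map_add (S.φ y) _ _
      map_smul' := fun _ _ => Fields.ext' fun y => map_smul (S.φ y) _ _ }
  unit := ContMDiffMap.ext S.unit_ξ
  η_ξ := ContMDiffMap.ext S.η_ξ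
  φ_sq X := Fields.ext' fun y => S.φ_sq y (X.1 y)
  φ_ξ := Fields.ext' S.φ_ξ
  dη X Y := Eq.trans (ContMDiffMap.ext fun y =>
    (S.dη_eq y X.1 Y.1 (X.diffAt y) (Y.diffAt y)).trans (two_mul _)) (two_mul _).symm
  killing := hK.isKilling

end Ricci

/-! ### Unique continuation by Grönwall's inequality -/

section UniqueContinuation

variable {E : Type*} [NormedAddCommGroup E] [NormedSpace ℝ E]
  {M : Type*} [TopologicalSpace M] [ChartedSpace E M] [IsManifold 𝓘(ℝ, E) ∞ M]

/-- The inverse of the tangent trivialization at x is the derivative of the inverse chart, so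
`chartFrame` consists of the coordinate fields and bounds along it are bounds on partial
derivatives. -/
theorem hasFDerivAt_comp_chart_symm {x : M} {z : E} (hz : z ∈ (extChartAt 𝓘(ℝ, E) x).target)
    {f : M → ℝ}
    (hf : MDifferentiableAt 𝓘(ℝ, E) 𝓘(ℝ, ℝ) f ((extChartAt 𝓘(ℝ, E) x).symm z)) :
    HasFDerivAt (f ∘ (extChartAt 𝓘(ℝ, E) x).symm)
      ((mvfderiv 𝓘(ℝ, E) f ((extChartAt 𝓘(ℝ, E) x).symm z)).comp
        ((trivializationAt E (TangentSpace 𝓘(ℝ, E)) x).symmL ℝ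
          ((extChartAt 𝓘(ℝ, E) x).symm z))) z := by
  have hy : (extChartAt 𝓘(ℝ, E) x).symm z ∈ (chartAt E x).source := by
    rw [← extChartAt_source 𝓘(ℝ, E)]; exact (extChartAt 𝓘(ℝ, E) x).map_target hz
  have h2 := (mdifferentiableWithinAt_extChartAt_symm (I := 𝓘(ℝ, E)) hz).hasMFDerivWithinAt
  have h3 := TangentBundle.symmL_trivializationAt (I := 𝓘(ℝ, E)) hy
  rw [(extChartAt 𝓘(ℝ, E) x).right_inv hz] at h3
  rw [← h3] at h2
  have h4 := hf.hasMFDerivAt.comp_hasMFDerivWithinAt z h2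
  rw [modelWithCornersSelf_coe, Set.range_id, hasMFDerivWithinAt_univ] at h4
  exact h4.hasFDerivAt

variable [FiniteDimensional ℝ E]

/-- Functions whose derivatives are bounded by the functions themselves vanish near a point as
soon as they vanish at one nearby point. -/
theorem exists_nhds_forall_eq_zero {κ : Type*} [Fintype κ] {f : κ → M → ℝ} {x : M}
    (hf : ∀ a, ContMDiff 𝓘(ℝ, E) 𝓘(ℝ, ℝ) ∞ (f a))
    (hd : ∀ k a, (dirDeriv (chartFrame (E := E) x k) (f a)) =O[nhds x]
      fun y => (fun a => f a y : κ → ℝ)) :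
    ∃ W ∈ nhds x, ∀ y₀ ∈ W, (∀ a, f a y₀ = 0) → ∀ y ∈ W, ∀ a, f a y = 0 := by
  set c := extChartAt 𝓘(ℝ, E) x with hc
  let b := Module.finBasis ℝ E
  let N : M → κ → ℝ := fun y a => f a y
  choose C hC using fun k a => (hd k a).bound
  have hev : ∀ᶠ y in nhds x, ∀ k a,
      ‖dirDeriv (chartFrame (E := E) x k) (f a) y‖ ≤ C k a * ‖N y‖ :=
    Filter.eventually_all.2 fun k => Filter.eventually_all.2 fun a => hC k a
  have hx : x ∈ c.source := mem_extChartAt_source x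
  have hsymm : Filter.Tendsto c.symm (nhds (c x)) (nhds x) := by
    have := (continuousAt_extChartAt_symm (I := 𝓘(ℝ, E)) x).tendsto
    rwa [← hc, c.left_inv hx] at this
  have htar : c.target ∈ nhds (c x) := extChartAt_target_mem_nhds x
  obtain ⟨r, hr, hball⟩ := Metric.eventually_nhds_iff_ball.1
    ((hsymm.eventually hev).and (Filter.eventually_of_mem htar fun z hz => hz))
  refine ⟨c.source ∩ c ⁻¹' Metric.ball (c x) r, Filter.inter_mem (extChartAt_source_mem_nhds x)
    ((continuousAt_extChartAt x).preimage_mem_nhds (Metric.ball_mem_nhds _ hr)), ?_⟩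
  rintro y₀ ⟨hy₀, hy₀r⟩ h0 y ⟨hy, hyr⟩ a
  set p := c y₀ with hp
  set u := c y - c y₀ with hu
  -- The segment from y₀ to y, read in the chart, stays in the ball where the derivative bounds
  -- hold.
  have hseg : ∀ t ∈ Set.Icc (0 : ℝ) 1, p + t • u ∈ Metric.ball (c x) r := fun t ht =>
    (convex_ball (c x) r).add_smul_sub_mem hy₀r hyr ht
  have hderiv : ∀ t ∈ Set.Icc (0 : ℝ) 1, ∀ a, HasDerivAt (fun t => f a (c.symm (p + t • u)))
      (∑ k, b.repr u k * dirDeriv (chartFrame (E := E) x k) (f a) (c.symm (p + t • u))) t := by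
    intro t ht a
    have hz := (hball _ (hseg t ht)).2
    have h1 := hasFDerivAt_comp_chart_symm hz
      (((hf a) (c.symm (p + t • u))).mdifferentiableAt (by simp))
    have h2 : HasDerivAt (fun t : ℝ => p + t • u) u t := by
      simpa using ((hasDerivAt_id t).smul_const u).const_add p
    have h3 := h1.comp_hasDerivAt t h2
    refine h3.congr_deriv ?_
    have hyb : c.symm (p + t • u) ∈ (trivializationAt E (TangentSpace 𝓘(ℝ, E)) x).baseSet := by
      rw [TangentBundle.trivializationAt_baseSet, ← extChartAt_source 𝓘(ℝ, E)]
      exact c.map_target hz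
    refine (congrArg _ (b.sum_repr u).symm).trans ?_
    rw [map_sum]
    refine Finset.sum_congr rfl fun k _ => ?_
    rw [map_smul, smul_eq_mul, dirDeriv, chartFrame,
      Bundle.Trivialization.localFrame_apply_of_mem_baseSet _ _ hyb]
    exact congrArg _ (congrArg _ (Bundle.Trivialization.symmL_apply _ hyb _))
  -- Summing over a as well gives one constant dominating the bound for each component, as the sup
  -- norm on κ → ℝ requires.
  let K : ℝ := ∑ a, ∑ k, |b.repr u k| * |C k a|
  have hK : 0 ≤ K := Finset.sum_nonneg fun a _ => Finset.sum_nonneg fun k _ => by positivity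
  have hg := eq_zero_of_abs_deriv_le_mul_abs_self_of_eq_zero_right (a := 0) (b := 1) (K := K)
    (f := fun t : ℝ => N (c.symm (p + t • u)))
    (f' := fun t a => ∑ k, b.repr u k *
      dirDeriv (chartFrame (E := E) x k) (f a) (c.symm (p + t • u)))
    (fun t ht => (hasDerivAt_pi.2 (hderiv t ht)).continuousAt.continuousWithinAt)
    (fun t ht => (hasDerivAt_pi.2 (hderiv t (Set.Ico_subset_Icc_self ht))).hasDerivWithinAt)
    (by
      funext a
      simp only [zero_smul, add_zero, hp, N, c.left_inv hy₀, h0 a]; rfl)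
    (by
      intro t ht
      refine (pi_norm_le_iff_of_nonneg (by positivity)).2 fun a => ?_
      calc ‖∑ k, b.repr u k * dirDeriv (chartFrame (E := E) x k) (f a) (c.symm (p + t • u))‖
          ≤ ∑ k, ‖b.repr u k * dirDeriv (chartFrame (E := E) x k) (f a) (c.symm (p + t • u))‖ :=
            norm_sum_le _ _
        _ ≤ ∑ k, |b.repr u k| * |C k a| * ‖N (c.symm (p + t • u))‖ := by
            refine Finset.sum_le_sum fun k _ => ?_
            rw [norm_mul, Real.norm_eq_abs, mul_assoc]
            refine mul_le_mul_of_nonneg_left ?_ (abs_nonneg _)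
            exact ((hball _ (hseg t (Set.Ico_subset_Icc_self ht))).1 k a).trans
              (mul_le_mul_of_nonneg_right (le_abs_self _) (norm_nonneg _))
        _ = (∑ k, |b.repr u k| * |C k a|) * ‖N (c.symm (p + t • u))‖ := by rw [Finset.sum_mul]
        _ ≤ K * ‖N (c.symm (p + t • u))‖ := by
            refine mul_le_mul_of_nonneg_right ?_ (norm_nonneg _)
            exact Finset.single_le_sum (f := fun a => ∑ k, |b.repr u k| * |C k a|)
              (fun a _ => Finset.sum_nonneg fun k _ => by positivity) (Finset.mem_univ a))
    1 (by simp)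
  have h1 : c.symm (p + (1 : ℝ) • u) = y := by
    rw [one_smul, hp, hu, add_sub_cancel, c.left_inv hy]
  have h2 := congrFun hg a
  simp only [h1] at h2
  exact h2

end UniqueContinuation

/-! ### The prolonged first-order system of a Killing field -/

namespace MetricLieRinehart

variable {A L : Type*} [CommRing A] [Algebra ℝ A] [LieRing L] [Module A L]
  (S : MetricLieRinehart A L) {ι : Type*} [Fintype ι] [DecidableEq ι] (F : CutoffFrame A L ι)
  {B : Type*} [CommRing B] {ev : A →+* B}

/-- Evaluation of an operator satisfying the Leibniz rule in a frame. -/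
theorem ev_θ_leibniz (hρ : ev F.ρ = 1) {X : L} (hdρ : ev (S.D X F.ρ) = 0) (N : L →+ L)
    (hN : ∀ (f : A) Y, N (f • Y) = S.D X f • Y + f • N Y) (l : ι) (Y : L) :
    ev (F.θ l (N Y)) = ev (S.D X (F.θ l Y)) + ∑ j, ev (F.θ j Y) * ev (F.θ l (N (F.e j))) := by
  have h := congrArg (fun X => ev (F.θ l (N X))) (F.sum_eq Y)
  simp only [map_sum, hN, map_add, map_smul, smul_eq_mul, map_mul, hρ, hdρ, F.dual, one_mul,
    zero_mul, zero_add, Finset.sum_add_distrib] at h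
  rw [← h, Finset.sum_eq_single l]
  · simp [hρ]
  · intro j _ hj; simp [hj.symm]
  · simp

theorem ev_D_eq_sum (hρ : ev F.ρ = 1) (V : L) (f : A) :
    ev (S.D V f) = ∑ j, ev (F.θ j V) * ev (S.D (F.e j) f) := by
  let N : L →+ A := AddMonoidHom.mk' (fun X => S.D X f) fun X Y => by
    rw [map_add, Derivation.add_apply]
  have hN : ∀ (a : A) X, N (a • X) = a * N X := fun a X => by
    simp [N]
  have h := congrArg (fun X => ev (N X)) (F.sum_eq V)
  simp only [map_sum, hN, map_mul, hρ, one_mul] at h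
  exact h.symm

/-- First half of the system, valid for any field: the derivative of a component of V along e_k is
read off from [e_k, V], using only components of V and of [V, e_k]. -/
theorem ev_D_θ (hρ : ev F.ρ = 1) (hdρ : ∀ X, ev (S.D X F.ρ) = 0) (V : L) (k l : ι) :
    ev (S.D (F.e k) (F.θ l V)) = -ev (F.θ l ⁅V, F.e k⁆)
      - ∑ j, ev (F.θ j V) * ev (F.θ l ⁅F.e k, F.e j⁆) := by
  have h := S.ev_θ_leibniz F hρ (hdρ (F.e k))
    (AddMonoidHom.mk' (fun Y => ⁅F.e k, Y⁆) (lie_add _)) (fun f Y => S.lie_smul _ _ _) l V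
  simp only [AddMonoidHom.mk'_apply] at h
  rw [← lie_skew V, map_neg, map_neg, h]
  ring

variable {S}

/-- Second half, which closes the system: [V, ∇_{e_k} e_i] = ∇_{[V, e_k]} e_i + ∇_{e_k} [V, e_i] is
solved for the last term. No second derivatives of V remain. -/
theorem IsKilling.ev_D_θ_lie {V : L} (hV : S.IsKilling V) (hρ : ev F.ρ = 1)
    (hdρ : ∀ X, ev (S.D X F.ρ) = 0) (k i l : ι) :
    ev (S.D (F.e k) (F.θ l ⁅V, F.e i⁆)) =
      ∑ j, ev (F.θ j V) * ev (S.D (F.e j) (F.θ l (S.nabla (F.e k) (F.e i))))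
      + ∑ m, ev (F.θ m (S.nabla (F.e k) (F.e i))) * ev (F.θ l ⁅V, F.e m⁆)
      - ∑ j, ev (F.θ j ⁅V, F.e k⁆) * ev (F.θ l (S.nabla (F.e j) (F.e i)))
      - ∑ j, ev (F.θ j ⁅V, F.e i⁆) * ev (F.θ l (S.nabla (F.e k) (F.e j))) := by
  have h1 := S.ev_θ_leibniz F hρ (hdρ (F.e k)) (S.nablaHom (F.e k))
    (fun f Y => S.nabla_smul_right _ _ _) l ⁅V, F.e i⁆
  have h2 := S.ev_θ_leibniz F hρ (hdρ V)
    (AddMonoidHom.mk' (fun Y => ⁅V, Y⁆) (lie_add _)) (fun f Y => S.lie_smul _ _ _) l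
    (S.nabla (F.e k) (F.e i))
  have h3 := congrArg (fun X => ev (F.θ l (S.nabla X (F.e i)))) (F.sum_eq ⁅V, F.e k⁆)
  simp only [S.nabla_sum_left, S.nabla_smul_left, map_sum, map_smul, smul_eq_mul, map_mul, hρ,
    one_mul] at h3
  simp only [AddMonoidHom.mk'_apply, nablaHom_apply] at h1 h2
  rw [hV.lie_nabla, map_add, map_add, S.ev_D_eq_sum F hρ V] at h2
  linear_combination h2 - h1 + h3

end MetricLieRinehart

/-! ### Killing fields vanishing on an open set -/

section KillingUniqueness

variable {E : Type*} [NormedAddCommGroup E] [NormedSpace ℝ E]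
  {M : Type*} [TopologicalSpace M] [ChartedSpace E M] [IsManifold 𝓘(ℝ, E) ∞ M]
  [FiniteDimensional ℝ E] [T2Space M]

/-- Evaluation of smooth functions at a point. -/
def evalAt (y : M) : Fun E M →+* ℝ :=
  ContMDiffMap.evalRingHom (I := 𝓘(ℝ, E)) (I' := 𝓘(ℝ, ℝ)) (n := ∞) y

@[simp] theorem evalAt_apply (y : M) (f : Fun E M) : evalAt y f = f y := rfl

theorem FrameAt.eventually_ρ {x : M} (F : FrameAt (E := E) x) (g : Metric E M) :
    ∀ᶠ y in nhds x, evalAt y F.ρ = 1 ∧ ∀ X, evalAt y ((lieRinehart g).D X F.ρ) = 0 := by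
  filter_upwards [F.ρ_one.eventually_nhds] with y hy
  refine ⟨hy.self_of_nhds, fun X => ?_⟩
  rw [evalAt_apply, lieRinehart_D_apply, dirDeriv_congr rfl (f' := fun _ => (1 : ℝ)) hy,
    dirDeriv_const]

open Asymptotics in
/-- A Killing field vanishing near some points close to `x` vanishes near `x`. -/
theorem exists_nhds_killing_eq_zero {g : Metric E M} {V : Fields E M}
    (hV : (lieRinehart g).IsKilling V) (x : M) :
    ∃ W ∈ nhds x, ∀ y₀ ∈ W, (V.1 =ᶠ[nhds y₀] 0) → ∀ y ∈ W, V.1 y = 0 := by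
  obtain ⟨F⟩ := nonempty_frameAt (E := E) x
  let f : Fin (Module.finrank ℝ E) ⊕ (Fin (Module.finrank ℝ E) × Fin (Module.finrank ℝ E)) →
      M → ℝ := Sum.elim (fun l => F.θ l V) (fun p => F.θ p.2 ⁅V, F.e p.1⁆)
  let N := fun y a => f a y
  have hf : ∀ a, ContMDiff 𝓘(ℝ, E) 𝓘(ℝ, ℝ) ∞ (f a) := by
    rintro (l | p)
    · exact (F.θ l V).contMDiff
    · exact (F.θ p.2 ⁅V, F.e p.1⁆).contMDiff
  have hbase : ∀ a, f a =O[nhds x] N := fun a =>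
    IsBigO.of_bound 1 (Filter.Eventually.of_forall fun y => by
      rw [one_mul]; exact norm_le_pi_norm (N y) a)
  have hmul : ∀ (h : Fun E M) {u : M → ℝ}, u =O[nhds x] N → (fun y => u y * h y) =O[nhds x] N := by
    intro h u hu
    have h1 : (h : M → ℝ) =O[nhds x] (fun _ => (1 : ℝ)) :=
      (h.contMDiff.continuous.continuousAt.tendsto).isBigO_one ℝ
    simpa only [mul_one, isBigO_norm_right] using hu.norm_right.mul h1
  have hsum : ∀ {u : Fin (Module.finrank ℝ E) → M → ℝ}, (∀ j, u j =O[nhds x] N) →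
      (fun y => ∑ j, u j y) =O[nhds x] N := fun {u} hu => by
    simpa only [Finset.sum_fn] using IsBigO.sum (s := Finset.univ) fun j _ => hu j
  have hmul' : ∀ (h : Fun E M) {u : M → ℝ}, u =O[nhds x] N →
      (fun y => h y * u y) =O[nhds x] N := fun h u hu => by
    simpa only [mul_comm] using hmul h hu
  have hv : ∀ l, (fun y => F.θ l V y) =O[nhds x] N := fun l => hbase (Sum.inl l)
  have hw : ∀ i l, (fun y => F.θ l ⁅V, F.e i⁆ y) =O[nhds x] N := fun i l => hbase (Sum.inr (i, l))
  have hfr : ∀ k (h : Fun E M), dirDeriv (chartFrame (E := E) x k) h =ᶠ[nhds x]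
      fun y => evalAt y ((lieRinehart g).D (F.e k) h) := by
    intro k h
    filter_upwards [F.e_eq] with y hy
    exact dirDeriv_congr (hy k).symm (Filter.EventuallyEq.refl _ _)
  obtain ⟨W, hW, hW0⟩ := exists_nhds_forall_eq_zero (E := E) hf (x := x) (by
    rintro k (l | ⟨i, l⟩)
    · refine IsBigO.congr' (f₁ := fun y => -F.θ l ⁅V, F.e k⁆ y -
        ∑ j, F.θ j V y * F.θ l ⁅F.e k, F.e j⁆ y) ?_ ?_ (Filter.EventuallyEq.refl _ _)
      · exact (hw k l).neg_left.sub (hsum fun j => hmul _ (hv j))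
      · filter_upwards [hfr k (F.θ l V), F.eventually_ρ g] with y hy hρ
        exact ((lieRinehart g).ev_D_θ F.toCutoffFrame hρ.1 hρ.2 V k l).symm.trans hy.symm
    · refine IsBigO.congr' (f₁ := fun y =>
        ∑ j, F.θ j V y * (lieRinehart g).D (F.e j) (F.θ l ((lieRinehart g).nabla (F.e k) (F.e i))) y
        + ∑ m, F.θ m ((lieRinehart g).nabla (F.e k) (F.e i)) y * F.θ l ⁅V, F.e m⁆ y
        - ∑ j, F.θ j ⁅V, F.e k⁆ y * F.θ l ((lieRinehart g).nabla (F.e j) (F.e i)) y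
        - ∑ j, F.θ j ⁅V, F.e i⁆ y * F.θ l ((lieRinehart g).nabla (F.e k) (F.e j)) y)
        ?_ ?_ (Filter.EventuallyEq.refl _ _)
      · exact (((hsum fun j => hmul _ (hv j)).add
          (hsum fun m => hmul' _ (hw m l))).sub
          (hsum fun j => hmul _ (hw k j))).sub (hsum fun j => hmul _ (hw i j))
      · filter_upwards [hfr k (F.θ l ⁅V, F.e i⁆), F.eventually_ρ g] with y hy hρ
        exact (hV.ev_D_θ_lie F.toCutoffFrame hρ.1 hρ.2 k i l).symm.trans hy.symm)
  -- Where ρ = 1 the components determine V, so their vanishing gives V = 0.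
  refine ⟨W ∩ {y | F.ρ y = 1}, Filter.inter_mem hW F.ρ_one, ?_⟩
  rintro y₀ ⟨hy₀, -⟩ h0 y ⟨hy, hρ⟩
  have hz := hW0 y₀ hy₀ (by
    -- The brackets [V, e_i] involve first derivatives of V, so vanishing near y₀ is used, not just
    -- at y₀.
    rintro (l | ⟨i, l⟩)
    · exact F.θ_zero l V y₀ h0.self_of_nhds
    · refine F.θ_zero l _ y₀ ?_
      exact (bracket_congr h0 (Filter.EventuallyEq.refl _ _)).trans
        (congrFun VectorField.mlieBracket_zero_left y₀)) y hy
  have h := congrArg (fun Y : Fields E M => Y.1 y) (F.sum_eq V)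
  have hρ : F.ρ y = 1 := hρ
  simp only [Fields.sum_apply, Fields.smul_apply, hρ, one_smul] at h
  rw [← h]
  refine Finset.sum_eq_zero fun l _ => ?_
  have : F.θ l V y = 0 := hz (Sum.inl l)
  rw [this, zero_smul]

/-- A Killing field on a connected manifold that vanishes on a nonempty open set is zero. -/
theorem killing_eq_zero [ConnectedSpace M] {g : Metric E M} {V : Fields E M}
    (hV : (lieRinehart g).IsKilling V) {x₀ : M} (h0 : V.1 =ᶠ[nhds x₀] 0) (x : M) : V.1 x = 0 := by
  let s : Set M := {y | V.1 =ᶠ[nhds y] 0}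
  have hopen : IsOpen s := isOpen_iff_mem_nhds.2 fun y hy => Filter.EventuallyEq.eventuallyEq_nhds hy
  have hclosed : IsClosed s := by
    -- The neighbourhood W of a limit point y is chosen before y₀, so it meets the vanishing set,
    -- and V = 0 on all of W.
    refine isClosed_of_closure_subset fun y hy => ?_
    obtain ⟨W, hW, h⟩ := exists_nhds_killing_eq_zero hV y
    obtain ⟨y₀, hy₀W, hy₀⟩ := mem_closure_iff_nhds.1 hy W hW
    exact Filter.eventually_of_mem hW (h y₀ hy₀W hy₀)
  have huniv : s = Set.univ := IsClopen.eq_univ ⟨hclosed, hopen⟩ ⟨x₀, h0⟩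
  have hx : V.1 =ᶠ[nhds x] 0 := show x ∈ s from huniv ▸ Set.mem_univ x
  exact hx.self_of_nhds

end KillingUniqueness

/-! ### Conclusion for K-contact Eta-Einstein manifolds -/

variable {E : Type*} [NormedAddCommGroup E] [NormedSpace ℝ E]
  {M : Type*} [TopologicalSpace M] [ChartedSpace E M] [IsManifold 𝓘(ℝ, E) ∞ M]
  [FiniteDimensional ℝ E]

/-- L_Z φ is to be tested on fields differentiable only at x; tensoriality reduces this to smooth
global fields. -/
theorem lie_endField_tensorialAt {φ : EndField E M} (hφ : SmoothEndField φ) (Z : VField E M)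
    (x : M) : TensorialAt 𝓘(ℝ, E) E
      (fun X : VField E M => bracket Z (fun y => φ y (X y)) x - φ x (bracket Z X x)) x where
  smul {f X} hf hX := by
    have h : (fun y => φ y ((f • X) y)) = f • fun y => φ y (X y) :=
      funext fun y => map_smul (φ y) (f y) (X y)
    rw [h, bracket_smul_right Z hf (diffAt_endField hφ hX), bracket_smul_right Z hf hX, map_add,
      map_smul, map_smul, smul_sub]
    abel
  add {X Y} hX hY := by
    have h : (fun y => φ y ((X + Y) y)) = (fun y => φ y (X y)) + fun y => φ y (Y y) :=
      funext fun y => map_add (φ y) (X y) (Y y)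
    rw [h, bracket_add_right Z (diffAt_endField hφ hX) (diffAt_endField hφ hY),
      bracket_add_right Z hX hY, map_add]
    abel

variable [T2Space M]

namespace ContactMetricStructure

variable {n : ℕ} (S : ContactMetricStructure E M n)

theorem ricci_eq {lam gam : M → ℝ} (hK : S.IsKContact)
    (hQ : ∀ (x : M) (v : TangentSpace 𝓘(ℝ, E) x),
      ricciOp S.g x v = lam x • v + (gam x * S.η x v) • S.ξ x)
    (x : M) (v w : TangentSpace 𝓘(ℝ, E) x) :
    ricci S.g x v w = lam x * S.g.inner x v w + gam x * (S.η x v * S.η x w) := by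
  obtain ⟨W, rfl⟩ := exists_fields_apply_eq (E := E) w
  have hη : S.η x (W.1 x) = S.g.inner x (S.ξ x) (W.1 x) :=
    congrArg (fun f : Fun E M => f x) ((S.kContact hK).η_eq W)
  rw [← inner_ricciOp, hQ, map_add, map_smul, map_smul, hη]
  exact congrArg _ (mul_assoc _ _ _)

/-- A Killing field commutes with the Reeb field wherever the Ricci tensor of an Eta-Einstein
K-contact structure is not proportional to the metric. -/
theorem mul_inner_bracket_ξ_eq_zero (hdim : Module.finrank ℝ E = 2 * n + 1) (hK : S.IsKContact)
    {lam gam : Fun E M}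
    (hQ : ∀ (x : M) (v : TangentSpace 𝓘(ℝ, E) x),
      ricciOp S.g x v = lam x • v + (gam x * S.η x v) • S.ξ x) :
    lam + gam = algebraMap ℝ (Fun E M) (2 * n) ∧
    ∀ {Z : Fields E M}, (lieRinehart S.g).IsKilling Z → ∀ (x : M) (X : Fields E M),
      gam x * S.g.inner x (bracket Z.1 S.ξ x) (X.1 x) = 0 := by
  let K := S.kContact hK
  have hric : ∀ {x : M} (F : FrameAt (E := E) x) {y : M}, F.ρ y = 1 → ∀ X Y : Fields E M,
      (lieRinehart S.g).ric F.toCutoffFrame X Y y =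
        (lam * (lieRinehart S.g).g X Y + gam * (K.η X * K.η Y) : Fun E M) y := by
    intro x F y hy X Y
    rw [← ricci_eq_ric S.g F hy, S.ricci_eq hK hQ]
    rfl
  have hc : lam + gam = algebraMap ℝ (Fun E M) (2 * n) := by
    ext x
    obtain ⟨F⟩ := nonempty_frameAt (E := E) x
    have hρ := F.ρ_one.self_of_nhds
    have h1 : (lieRinehart S.g).ric F.toCutoffFrame K.ξ K.ξ x = _ :=
      MetricLieRinehart.KContact.ev_ric_ξ_ξ (ev := evalAt x) F.toCutoffFrame K hρ
    rw [hric F hρ, Fintype.card_fin, hdim, K.unit, K.η_ξ, mul_one, mul_one, mul_one] at h1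
    rw [h1]
    change _ = (2 * n : ℝ)
    push_cast
    ring
  refine ⟨hc, fun {Z} hZ x X => ?_⟩
  obtain ⟨F⟩ := nonempty_frameAt (E := E) x
  have hρ := (F.eventually_ρ S.g).self_of_nhds
  refine MetricLieRinehart.KContact.ev_gam_lie_ξ (ev := evalAt x) F.toCutoffFrame K hc hZ hρ.1
    (hρ.2 Z) (fun X Y => hric F hρ.1 X Y) (fun X Y => ?_) X
  -- The formula for Ric holds on a neighbourhood of x, so it may be differentiated at x.
  exact dirDeriv_congr rfl (F.ρ_one.mono fun y hy => hric F hy X Y)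

theorem bracket_ξ_eq_zero [ConnectedSpace M] (hdim : Module.finrank ℝ E = 2 * n + 1)
    (hK : S.IsKContact) (hEta : S.IsGeneralizedEtaEinstein) (hE : ¬ IsEinstein S.g)
    {Z : VField E M} (hZ : IsInfinitesimalIsometry S.g Z) (x : M) : bracket Z S.ξ x = 0 := by
  obtain ⟨lam, gam, hlam, hgam, hQ⟩ := hEta
  obtain ⟨hc, hV⟩ := S.mul_inner_bracket_ξ_eq_zero (lam := ⟨lam, hlam⟩) (gam := ⟨gam, hgam⟩)
    hdim hK hQ
  -- If γ vanished identically, λ = 2n would be the Einstein constant.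
  obtain ⟨x₀, hx₀⟩ : ∃ x₀, gam x₀ ≠ 0 := by
    by_contra! h
    refine hE ⟨2 * n, fun x v w => ?_⟩
    have hx : lam x + gam x = 2 * n := congrArg (fun f : Fun E M => f x) hc
    rw [S.ricci_eq hK hQ, h x, zero_mul, add_zero, ← hx, h x, add_zero]
  refine killing_eq_zero (hZ.isKilling.lie (S.kContact hK).killing) (x₀ := x₀) ?_ x
  filter_upwards [hgam.continuous.continuousAt.eventually_ne hx₀] with y hy
  exact inner_eq_zero S.g ((mul_eq_zero.1 (hV hZ.isKilling y _)).resolve_left hy)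

theorem lie_η_eq_zero (hK : S.IsKContact) {Z : VField E M} (hZ : IsInfinitesimalIsometry S.g Z)
    (h : ∀ x, bracket Z S.ξ x = 0) : LiePreservesForm S.η Z := by
  have hη : ∀ (x : M) (v : TangentSpace 𝓘(ℝ, E) x), S.η x v = S.g.inner x (S.ξ x) v := by
    intro x v
    obtain ⟨W, rfl⟩ := exists_fields_apply_eq (E := E) v
    exact congrArg (fun f : Fun E M => f x) ((S.kContact hK).η_eq W)
  intro x X hX
  have h1 := hZ.2 x S.ξ X (S.smooth_ξ.diffAt x) hX
  rw [h x, map_zero] at h1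
  simp only [hη]
  simpa using h1

theorem lie_φ_eq_zero (hK : S.IsKContact) {Z : VField E M} (hZ : IsInfinitesimalIsometry S.g Z)
    (h : ∀ x, bracket Z S.ξ x = 0) : LiePreservesEnd S.φ Z := by
  intro x X hX
  -- Y is a smooth field with the same value at x as X; by tensoriality it may replace X.
  obtain ⟨Y, hY⟩ := exists_fields_apply_eq (E := E) (X x)
  have h1 : ⁅(⟨Z, hZ.1⟩ : Fields E M), (S.kContact hK).ξ⁆ = 0 := Fields.ext' h
  have h2 := congrArg (fun W : Fields E M => W.1 x)
    ((S.kContact hK).lie_φ hZ.isKilling h1 Y)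
  rw [(lie_endField_tensorialAt S.smooth_φ Z x).pointwise hX (Y.diffAt x) hY.symm]
  exact sub_eq_zero.2 h2

end ContactMetricStructure

end ContactGeometry

end

theorem mainTheorem6 (n : ℕ)
    {E : Type*} [NormedAddCommGroup E] [NormedSpace ℝ E] [FiniteDimensional ℝ E]
    (hdim : Module.finrank ℝ E = 2 * n + 1)
    {M : Type*} [TopologicalSpace M] [T2Space M] [SecondCountableTopology M] [ConnectedSpace M]
    [ChartedSpace E M] [IsManifold 𝓘(ℝ, E) ∞ M]
    (S : ContactGeometry.ContactMetricStructure E M n)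
    (hK : S.IsKContact)
    (hEta : S.IsGeneralizedEtaEinstein)
    (hNotEinstein : ¬ ContactGeometry.IsEinstein S.g)
    (Z : ContactGeometry.VField E M)
    (hZ : ContactGeometry.IsInfinitesimalIsometry S.g Z) :
    S.IsInfinitesimalAutomorphism Z :=
  have h := S.bracket_ξ_eq_zero hdim hK hEta hNotEinstein hZ
  ⟨hZ.1, S.lie_η_eq_zero hK hZ h, h, S.lie_φ_eq_zero hK hZ h, hZ.2⟩
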